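/- Let $m\ge 1$ and let $w_t=[\xi_t,v_t']'$, $t\in\mathbb Z$, be an $\mathbb R^{1+m}$-valued strictly stationary and ergodic process with $E(w_t)=0$, finite positive definite covariance matrix $E(w_tw_t')$, a spectral density matrix $f_{ww}$ that is continuous on $(-\pi,\pi]$, and positive definite long-run covariance matrix $\Omega=2\pi f_{ww}(0)$, with blocks $\Omega_{\xi\xi},\Omega_{\xi v},\Omega_{v\xi},\Omega_{vv}$. Suppose that $$T^{-1/2}\sum_{t=1}^{\lfloor rT\rfloor}w_t\Rightarrow \Omega^{1/2}W(r),\qquad 0\le r\le 1,$$ weakly in the Skorokhod space $D([0,1],\mathbb R^{1+m})$, where $W=[W_{\xi\cdot v},W_v']'$ is a vector of $1+m$ independent standard Brownian motions, $$\Omega^{1/2}=\begin{bmatrix}\Omega_{\xi\cdot v}^{1/2}&\Omega_{\xi v}(\Omega_{vv}^{-1/2})'\\0&\Omega_{vv}^{1/2}\end{bmatrix},\qquad \Omega_{\xi\cdot v}=\Omega_{\xi\xi}-\Omega_{\xi v}\Omega_{vv}^{-1}\Omega_{v\xi},$$ and $\Omega_{vv}^{1/2}$ is any matrix with $\Omega_{vv}^{1/2}(\Omega_{vv}^{1/2})'=\Omega_{vv}$.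 Let $c\le 0$ and, for sample size $T$ and $t=1,\dots,T$, $$x_t=\mu+x_{t-1}+v_t,\qquad y_{T,t}=d_t'\tau+x_t'\beta+u_{T,t},\qquad u_{T,t}=\rho_Tu_{T,t-1}+\xi_t,\quad \rho_T=1+c/T,$$ where $\mu,\beta\in\mathbb R^m$ and $\tau$ are fixed, $x_0$ is a random vector and $T^{-1/2}u_{T,0}\to0$ in probability (as is the case if $u_{T,0}=O_{P}(1)$). Consider the cases D0: $x_0=\mu=0$ and no $d_t$; D1: $\mu=0$ and $d_t=1$; D2: $d_t=[1,t]'$. In case D0 let $\widetilde y_t=y_{T,t}$, $\widetilde x_t=x_t$; in cases D1 and D2 let $\widetilde y_t,\widetilde x_t$ be the residuals of the OLS regressions of $y_{T,t}$ and $x_t$ on $d_t$, $t=1,\dots,T$. Let $\widehat u_t$ be the residuals of the OLS regression of $\widetilde y_t$ on $\widetilde x_t$, and $$\mathrm{VR}=\frac{T^{-2}\sum_{t=1}^T\big(\sum_{s=1}^t\widehat u_s\big)^2}{\sum_{t=1}^T\widehat u_t^2}.$$ For a path $P$ on $[0,1]$ let $\widetilde P(r)=P(r)$ in case D0, $\widetilde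 P(r)=P(r)-\int_0^1P(s)\,ds$ in case D1, and $\widetilde P(r)=P(r)-(4-6r)\int_0^1P(s)\,ds-(12r-6)\int_0^1sP(s)\,ds$ in case D2. Let $R^2=\Omega_{\xi\xi}^{-1}\Omega_{\xi v}\Omega_{vv}^{-1}\Omega_{v\xi}$, $\overline W_v=m^{-1/2}(1,\dots,1)W_v$, $$J^c_{\xi\cdot v}(r)=\int_0^re^{(r-s)c}\,d\Big(W_{\xi\cdot v}(s)+\sqrt{R^2/(1-R^2)}\;\overline W_v(s)\Big),$$ $$\widetilde J^{c,+}_{\xi\cdot v}(r)=\widetilde J^c_{\xi\cdot v}(r)-\widetilde W_v(r)'\Big(\int_0^1\widetilde W_v(s)\widetilde W_v(s)'ds\Big)^{-1}\int_0^1\widetilde W_v(s)\widetilde J^c_{\xi\cdot v}(s)\,ds .$$ Then, in each of the cases D0, D1 and D2, as $T\to\infty$, $$\mathrm{VR}\ \Rightarrow\ \mathcal G_{\mathrm{VR},c}=\frac{\int_0^1\big(\int_0^r\widetilde J^{c,+}_{\xi\cdot v}(s)\,ds\big)^2dr}{\int_0^1\big(\widetilde J^{c,+}_{\xi\cdot v}(r)\big)^2dr}.$$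 Moreover, in each case the law of $\mathcal G_{\mathrm{VR},c}$, and hence the local asymptotic power at any level $\alpha\in(0,1)$, i.e. the probability that $\mathcal G_{\mathrm{VR},c}$ is smaller than the $\alpha$-quantile of the limiting null distribution (the law of the same ratio with $\widetilde J^c_{\xi\cdot v}$ replaced by $\widetilde W_{\xi\cdot v}$), depends only on $c$, $m$ and $R^2$: both are unchanged if $W$ is replaced by any other $(1+m)$-dimensional standard Brownian motion. -/

import Mathlib

namespace VarianceRatio

open MeasureTheory ProbabilityTheory Filter Set Topology
open scoped unitInterval NNReal ENNReal Matrix ComplexOrder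

/-! ### The Skorokhod space `D([0,1], E)` -/

section Skorokhod

variable {E : Type*}

/-- Right-continuity with left limits on `[0,1]`. -/
def IsCadlag [TopologicalSpace E] (p : I → E) : Prop :=
  ∀ r : I, ContinuousWithinAt p (Ici r) r ∧ ∃ l : E, Tendsto p (𝓝[<] r) (𝓝 l)

/-- The space `D([0,1], E)` of càdlàg paths. -/
structure SkorokhodSpace (E : Type*) [TopologicalSpace E] where
  toFun : I → E
  cadlag : IsCadlag toFun

/-- The cost of matching the path `p` with the path `q` through the time change `θ`
(an increasing bijection of `[0,1]`). -/
noncomputable def matchCost [PseudoEMetricSpace E] (p q : I → E) (θ : I ≃o I) : ℝ≥0∞ :=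
  max (⨆ r : I, edist r (θ r)) (⨆ r : I, edist (p r) (q (θ r)))

/-- Skorokhod's `J₁` distance. -/
noncomputable def skorokhodDist [PseudoEMetricSpace E] (p q : I → E) : ℝ≥0∞ :=
  ⨅ θ : I ≃o I, matchCost p q θ

theorem matchCost_refl [PseudoEMetricSpace E] (p : I → E) :
    matchCost p p (OrderIso.refl I) = 0 := by
  simp [matchCost]

theorem matchCost_symm [PseudoEMetricSpace E] (p q : I → E) (θ : I ≃o I) :
    matchCost q p θ.symm = matchCost p q θ := by
  unfold matchCost
  congr 1
  · rw [← θ.toEquiv.iSup_comp]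
    simp [edist_comm]
  · rw [← θ.toEquiv.iSup_comp]
    simp [edist_comm]

theorem matchCost_trans [PseudoEMetricSpace E] (p q s : I → E) (θ η : I ≃o I) :
    matchCost p s (θ.trans η) ≤ matchCost p q θ + matchCost q s η := by
  unfold matchCost
  refine max_le (iSup_le fun r => ?_) (iSup_le fun r => ?_)
  · refine (edist_triangle r (θ r) (η (θ r))).trans (add_le_add ?_ ?_)
    · exact (le_iSup (fun r : I => edist r (θ r)) r).trans (le_max_left _ _)
    · exact (le_iSup (fun r : I => edist r (η r)) (θ r)).trans (le_max_left _ _)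
  · refine (edist_triangle (p r) (q (θ r)) (s (η (θ r)))).trans (add_le_add ?_ ?_)
    · exact (le_iSup (fun r : I => edist (p r) (q (θ r))) r).trans (le_max_right _ _)
    · exact (le_iSup (fun r : I => edist (q r) (s (η r))) (θ r)).trans (le_max_right _ _)

/-- The `J₁` topology, given by Skorokhod's distance. -/
noncomputable instance [PseudoEMetricSpace E] : PseudoEMetricSpace (SkorokhodSpace E) where
  edist p q := skorokhodDist p.toFun q.toFun
  edist_self p := le_antisymm
    ((iInf_le _ (OrderIso.refl I)).trans (matchCost_refl p.toFun).le) zero_le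
  edist_comm p q := by
    have key : ∀ a b : I → E, skorokhodDist a b ≤ skorokhodDist b a := fun a b =>
      le_iInf fun θ => (iInf_le _ θ.symm).trans (matchCost_symm b a θ).le
    exact le_antisymm (key _ _) (key _ _)
  edist_triangle p q s := by
    refine ENNReal.le_iInf_add_iInf fun θ η => ?_
    exact (iInf_le _ (θ.trans η)).trans (matchCost_trans _ _ _ θ η)

/-- The Borel σ-algebra of the `J₁` topology. -/
noncomputable instance [PseudoEMetricSpace E] : MeasurableSpace (SkorokhodSpace E) :=
  borel (SkorokhodSpace E)

instance [PseudoEMetricSpace E] : BorelSpace (SkorokhodSpace E) := ⟨rfl⟩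

theorem isCadlag_of_continuous [TopologicalSpace E] {p : I → E} (hp : Continuous p) :
    IsCadlag p :=
  fun r => ⟨hp.continuousWithinAt, p r, hp.continuousAt.tendsto.mono_left nhdsWithin_le_nhds⟩

/-- The step function `r ↦ a ⌊rT⌋` is càdlàg. -/
theorem isCadlag_step [TopologicalSpace E] (T : ℕ) (a : ℕ → E) :
    IsCadlag fun r : I => a ⌊(r : ℝ) * T⌋₊ := by
  intro r
  have hc : Continuous fun s : I => (s : ℝ) * T := by fun_prop
  constructor
  · have h1 : Tendsto (fun s : I => (s : ℝ) * T) (𝓝[≥] r) (𝓝[≥] ((r : ℝ) * T)) := by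
      refine tendsto_nhdsWithin_iff.2 ⟨hc.continuousAt.tendsto.mono_left nhdsWithin_le_nhds, ?_⟩
      filter_upwards [self_mem_nhdsWithin] with s hs
      exact mul_le_mul_of_nonneg_right (show (r : ℝ) ≤ s from hs) (Nat.cast_nonneg T)
    have h2 := (tendsto_floor_right_pure_floor ((r : ℝ) * T)).comp h1
    refine Tendsto.mono_right ?_ (pure_le_nhds _)
    rw [tendsto_pure] at h2 ⊢
    filter_upwards [h2] with s hs
    simp only [Function.comp] at hs
    rw [← Int.floor_toNat, ← Int.floor_toNat, hs]
  · rcases Nat.eq_zero_or_pos T with rfl | hT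
    · refine ⟨a 0, ?_⟩
      simp only [Nat.cast_zero, mul_zero, Nat.floor_zero]
      exact tendsto_const_nhds
    · have hT' : (0 : ℝ) < T := Nat.cast_pos.2 hT
      have h1 : Tendsto (fun s : I => (s : ℝ) * T) (𝓝[<] r) (𝓝[<] ((r : ℝ) * T)) := by
        refine tendsto_nhdsWithin_iff.2
          ⟨hc.continuousAt.tendsto.mono_left nhdsWithin_le_nhds, ?_⟩
        filter_upwards [self_mem_nhdsWithin] with s hs
        exact mul_lt_mul_of_pos_right (show (s : ℝ) < r from hs) hT'
      have h2 := (tendsto_floor_left_pure_ceil_sub_one ((r : ℝ) * T)).comp h1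
      refine ⟨a (⌈(r : ℝ) * T⌉ - 1).toNat, Tendsto.mono_right ?_ (pure_le_nhds _)⟩
      rw [tendsto_pure] at h2 ⊢
      filter_upwards [h2] with s hs
      simp only [Function.comp] at hs
      rw [← Int.floor_toNat, hs]

end Skorokhod

/-! ### The error process -/

section Errors

variable {Ω Ω' : Type*} [MeasurableSpace Ω] [MeasurableSpace Ω'] {m : ℕ}

/-- Coordinates of `w_t = [ξ_t, v_t']'`: `inl ()` for `ξ`, `inr j` for the `j`-th entry of `v`. -/
abbrev Idx (m : ℕ) := Unit ⊕ Fin m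

/-- Autocovariances `E(w_h w_0')` of a centred stationary process. -/
noncomputable def autocov (w : ℤ → Ω → Idx m → ℝ) (P : Measure Ω) (h : ℤ) :
    Matrix (Idx m) (Idx m) ℝ :=
  Matrix.of fun i j => ∫ ω, w h ω i * w 0 ω j ∂P

/-- `f` is a spectral density matrix, on `(-π, π]`, for the autocovariance function `Γ`. -/
structure IsSpectralDensity (Γ : ℤ → Matrix (Idx m) (Idx m) ℝ)
    (f : ℝ → Matrix (Idx m) (Idx m) ℂ) : Prop where
  posSemidef : ∀ l ∈ Ioc (-Real.pi) Real.pi, (f l).PosSemidef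
  integrable : ∀ i j, IntegrableOn (fun l => f l i j) (Ioc (-Real.pi) Real.pi)
  fourier : ∀ (h : ℤ) (i j : Idx m),
    (Γ h i j : ℂ) = ∫ l in (-Real.pi)..Real.pi, Complex.exp (Complex.I * h * l) * f l i j

/-- `Lrv` is the long-run covariance matrix `2π f(0)`, for a spectral density matrix `f` that is
continuous on `(-π, π]`. -/
def IsLongRunCov (w : ℤ → Ω → Idx m → ℝ) (P : Measure Ω)
    (Lrv : Matrix (Idx m) (Idx m) ℝ) : Prop :=
  ∃ f : ℝ → Matrix (Idx m) (Idx m) ℂ, IsSpectralDensity (autocov w P) f ∧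
    ContinuousOn f (Ioc (-Real.pi) Real.pi) ∧
    ∀ i j, (Lrv i j : ℂ) = 2 * Real.pi * f 0 i j

/-- The conditional long-run variance `Ω_{ξ·v} = Ω_ξξ - Ω_ξv Ω_vv⁻¹ Ω_vξ`. -/
noncomputable def condVar (Lrv : Matrix (Idx m) (Idx m) ℝ) : ℝ :=
  (Lrv.toBlocks₁₁ - Lrv.toBlocks₁₂ * Lrv.toBlocks₂₂⁻¹ * Lrv.toBlocks₂₁) () ()

/-- `R² = Ω_ξξ⁻¹ Ω_ξv Ω_vv⁻¹ Ω_vξ`. -/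
noncomputable def rSq (Lrv : Matrix (Idx m) (Idx m) ℝ) : ℝ :=
  (Lrv.toBlocks₁₁⁻¹ * Lrv.toBlocks₁₂ * Lrv.toBlocks₂₂⁻¹ * Lrv.toBlocks₂₁) () ()

/-- The block-triangular root `Ω^{1/2}` built from a root `S = Ω_vv^{1/2}`. -/
noncomputable def lrvRoot (Lrv : Matrix (Idx m) (Idx m) ℝ) (S : Matrix (Fin m) (Fin m) ℝ) :
    Matrix (Idx m) (Idx m) ℝ :=
  Matrix.fromBlocks (Matrix.of fun _ _ => √(condVar Lrv)) (Lrv.toBlocks₁₂ * S⁻¹ᵀ) 0 S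

/-- A vector `W = [W_{ξ·v}, W_v']'` of `1 + m` independent standard Brownian motions, with
continuous paths. -/
structure IsStdBrownian (W : Idx m → ℝ≥0 → Ω' → ℝ) (P' : Measure Ω') : Prop where
  measurable : ∀ i t, Measurable (W i t)
  continuous : ∀ i ω, Continuous fun t => W i t ω
  brownian : ∀ i, IsBrownianReal (W i) P'
  indep : iIndepFun (fun i ω t => W i t ω) P'

/-- `r ↦ T^{-1/2} ∑_{t ≤ ⌊rT⌋} w_t`, as an element of `D([0,1], ℝ^{1+m})`. -/
noncomputable def partialSumPath (w : ℤ → Ω → Idx m → ℝ) (T : ℕ) (ω : Ω) :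
    SkorokhodSpace (Idx m → ℝ) where
  toFun r := (√(T : ℝ))⁻¹ • ∑ t ∈ Finset.Icc 1 ⌊(r : ℝ) * T⌋₊, w t ω
  cadlag := isCadlag_step T fun n => (√(T : ℝ))⁻¹ • ∑ t ∈ Finset.Icc 1 n, w t ω

/-- `r ↦ A W(r)`, as an element of `D([0,1], ℝ^{1+m})`. -/
noncomputable def brownianPath (A : Matrix (Idx m) (Idx m) ℝ) (W : Idx m → ℝ≥0 → Ω' → ℝ)
    (hW : ∀ i ω, Continuous fun t => W i t ω) (ω : Ω') : SkorokhodSpace (Idx m → ℝ) where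
  toFun r := A *ᵥ fun i => W i (Real.toNNReal r) ω
  cadlag := isCadlag_of_continuous <| by
    refine Continuous.matrix_mulVec continuous_const (continuous_pi fun i => ?_)
    exact (hW i ω).comp (continuous_real_toNNReal.comp continuous_subtype_val)

/-- The assumption on the errors `w_t = [ξ_t, v_t']'`: strict stationarity and ergodicity, mean
zero, finite positive definite covariance matrix, continuous spectral density matrix, positive
definite long-run covariance matrix `Lrv`, and the functional central limit theorem with limit
`Ω^{1/2} W`. -/
structure ErrorAssumption (w : ℤ → Ω → Idx m → ℝ) (P : Measure Ω) [IsProbabilityMeasure P]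
    (Lrv : Matrix (Idx m) (Idx m) ℝ) (S : Matrix (Fin m) (Fin m) ℝ)
    (W : Idx m → ℝ≥0 → Ω' → ℝ) (P' : Measure Ω') [IsProbabilityMeasure P'] : Prop where
  measurable : ∀ t, Measurable (w t)
  /-- `Ergodic` contains that the shift preserves the law of the process. -/
  stationary_ergodic :
    Ergodic (fun (p : ℤ → Idx m → ℝ) t => p (t + 1)) (P.map fun ω t => w t ω)
  memLp : ∀ t i, MemLp (fun ω => w t ω i) 2 P
  mean_zero : ∀ t i, ∫ ω, w t ω i ∂P = 0
  cov_posDef : (autocov w P 0).PosDef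
  longRunCov : IsLongRunCov w P Lrv
  lrv_posDef : Lrv.PosDef
  root : S * Sᵀ = Lrv.toBlocks₂₂
  brownian : IsStdBrownian W P'
  fclt : TendstoInDistribution (partialSumPath w) atTop
    (brownianPath (lrvRoot Lrv S) W brownian.continuous) (fun _ => P) P'

end Errors

/-! ### Deterministic components, detrending and the test statistic -/

/-- The specifications: no deterministics, intercept, intercept and linear trend. -/
inductive DetCase
  | D0
  | D1
  | D2

/-- The number of deterministic regressors. -/
def DetCase.dim : DetCase → ℕ
  | .D0 => 0
  | .D1 => 1
  | .D2 => 2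

/-- `d_t`: empty in case D0, `1` in case D1, `[1, t]'` in case D2. -/
def DetCase.d (k : DetCase) (t : ℕ) : Fin k.dim → ℝ := fun i => (t : ℝ) ^ (i : ℕ)

/-- Restrictions on the drift and on the initial value of the regressors. -/
def DetCase.Restriction {Ω : Type*} {m : ℕ} (k : DetCase) (drift : Fin m → ℝ)
    (x0 : Ω → Fin m → ℝ) : Prop :=
  match k with
  | .D0 => drift = 0 ∧ ∀ ω, x0 ω = 0
  | .D1 => drift = 0
  | .D2 => True

/-- OLS detrending of a scalar series observed at `t = 1, …, T` (in case D0 the sums over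
`Fin 0` vanish and the series is unchanged). -/
noncomputable def olsDetrend (k : DetCase) (T : ℕ) (z : ℕ → ℝ) (t : ℕ) : ℝ :=
  z t - k.d t ⬝ᵥ ((∑ s ∈ Finset.Icc 1 T, Matrix.vecMulVec (k.d s) (k.d s))⁻¹ *ᵥ
    ∑ s ∈ Finset.Icc 1 T, z s • k.d s)

/-- The OLS detrended regressors `x̃_t`. -/
noncomputable def detrendedX {m : ℕ} (k : DetCase) (T : ℕ) (x : ℕ → Fin m → ℝ) (t : ℕ) :
    Fin m → ℝ :=
  fun j => olsDetrend k T (fun s => x s j) t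

/-- The OLS estimator in the regression of `ỹ_t` on `x̃_t`. -/
noncomputable def betaHat {m : ℕ} (k : DetCase) (T : ℕ) (y : ℕ → ℝ) (x : ℕ → Fin m → ℝ) :
    Fin m → ℝ :=
  (∑ s ∈ Finset.Icc 1 T, Matrix.vecMulVec (detrendedX k T x s) (detrendedX k T x s))⁻¹ *ᵥ
    ∑ s ∈ Finset.Icc 1 T, olsDetrend k T y s • detrendedX k T x s

/-- The OLS residuals `û_t`. -/
noncomputable def residual {m : ℕ} (k : DetCase) (T : ℕ) (y : ℕ → ℝ) (x : ℕ → Fin m → ℝ)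
    (t : ℕ) : ℝ :=
  olsDetrend k T y t - detrendedX k T x t ⬝ᵥ betaHat k T y x

/-- The variance ratio statistic `VR`. -/
noncomputable def VR {m : ℕ} (k : DetCase) (T : ℕ) (y : ℕ → ℝ) (x : ℕ → Fin m → ℝ) : ℝ :=
  (((T : ℝ) ^ 2)⁻¹ *
      ∑ t ∈ Finset.Icc 1 T, (∑ s ∈ Finset.Icc 1 t, residual k T y x s) ^ 2) /
    ∑ t ∈ Finset.Icc 1 T, residual k T y x t ^ 2

/-! ### The limiting functional -/

/-- The detrended path `P̃` of a path `P` on `[0,1]`. -/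
noncomputable def detrendPath {E : Type*} [NormedAddCommGroup E] [NormedSpace ℝ E]
    (k : DetCase) (p : ℝ → E) (r : ℝ) : E :=
  match k with
  | .D0 => p r
  | .D1 => p r - ∫ s in (0 : ℝ)..1, p s
  | .D2 => p r - (4 - 6 * r) • (∫ s in (0 : ℝ)..1, p s) -
      (12 * r - 6) • ∫ s in (0 : ℝ)..1, s • p s

/-- `∫_a^b f dg` as the limit of left-endpoint sums over `n` equal subintervals. For `f`
continuously differentiable and `g` a Brownian path the limit exists for every such path, being
the Riemann-Stieltjes integral, and it is the Itô (Wiener) integral. -/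
noncomputable def pathIntegral (f g : ℝ → ℝ) (a b : ℝ) : ℝ :=
  limUnder atTop fun n : ℕ => ∑ i ∈ Finset.range n,
    f (a + (b - a) * (i / n)) *
      (g (a + (b - a) * ((i + 1) / n)) - g (a + (b - a) * (i / n)))

/-- `p - q' (∫ q q')⁻¹ ∫ q p`: the path `p` after projecting out the path `q` in `L²[0,1]`. -/
noncomputable def projectOut {m : ℕ} (p : ℝ → ℝ) (q : ℝ → Fin m → ℝ) (r : ℝ) : ℝ :=
  p r - q r ⬝ᵥ
    ((Matrix.of fun i j => ∫ s in (0 : ℝ)..1, q s i * q s j)⁻¹ *ᵥ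
      fun i => ∫ s in (0 : ℝ)..1, q s i * p s)

/-- `∫₀¹ (∫₀ʳ g)² dr / ∫₀¹ g²`. -/
noncomputable def ratioFunctional (g : ℝ → ℝ) : ℝ :=
  (∫ r in (0 : ℝ)..1, (∫ s in (0 : ℝ)..r, g s) ^ 2) / ∫ r in (0 : ℝ)..1, g r ^ 2

section Limit

variable {Ω' : Type*} {m : ℕ}

/-- The path of `W_{ξ·v}`. -/
def pathXi (W : Idx m → ℝ≥0 → Ω' → ℝ) (ω : Ω') (r : ℝ) : ℝ := W (.inl ()) r.toNNReal ω

/-- The path of `W_v`. -/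
def pathV (W : Idx m → ℝ≥0 → Ω' → ℝ) (ω : Ω') (r : ℝ) : Fin m → ℝ :=
  fun j => W (.inr j) r.toNNReal ω

/-- The driving process `W_{ξ·v} + √(R²/(1-R²)) W̄_v`, with `W̄_v = m^{-1/2} 1_m' W_v`. -/
noncomputable def driver (R2 : ℝ) (W : Idx m → ℝ≥0 → Ω' → ℝ) (ω : Ω') (r : ℝ) : ℝ :=
  pathXi W ω r + √(R2 / (1 - R2)) * ((√(m : ℝ))⁻¹ * ∑ j, pathV W ω r j)

/-- The Ornstein-Uhlenbeck process `J^c(r) = ∫_0^r e^{(r-s)c} d(driver)(s)`. -/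
noncomputable def ouPath (c R2 : ℝ) (W : Idx m → ℝ≥0 → Ω' → ℝ) (ω : Ω') (r : ℝ) : ℝ :=
  pathIntegral (fun s => Real.exp ((r - s) * c)) (driver R2 W ω) 0 r

/-- The limit variable `G_{VR,c}`. -/
noncomputable def limitVR (k : DetCase) (c R2 : ℝ) (W : Idx m → ℝ≥0 → Ω' → ℝ) (ω : Ω') : ℝ :=
  ratioFunctional
    (projectOut (detrendPath k (ouPath c R2 W ω)) (detrendPath k (pathV W ω)))

/-- The limit variable under the null hypothesis of no cointegration. -/
noncomputable def nullLimitVR (k : DetCase) (W : Idx m → ℝ≥0 → Ω' → ℝ) (ω : Ω') : ℝ :=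
  ratioFunctional
    (projectOut (detrendPath k (pathXi W ω)) (detrendPath k (pathV W ω)))

/-- The `α`-quantile of a law on `ℝ`. -/
noncomputable def quantile (ν : Measure ℝ) (α : ℝ) : ℝ := sInf {q : ℝ | α ≤ ν.real (Iic q)}

/-- Local asymptotic power of the (left-tailed) test at level `α`: the probability that `G_{VR,c}`
is smaller than the `α`-quantile of the limiting null distribution. -/
noncomputable def localPower [MeasurableSpace Ω'] (k : DetCase) (c R2 : ℝ)
    (W : Idx m → ℝ≥0 → Ω' → ℝ) (P' : Measure Ω') (α : ℝ) : ℝ :=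
  P'.real {ω | limitVR k c R2 W ω < quantile (P'.map (nullLimitVR k W)) α}

end Limit

end VarianceRatio

open VarianceRatio MeasureTheory ProbabilityTheory Filter
open scoped NNReal Matrix

namespace VarianceRatio

open Set Topology

/-! ### Uniform convergence of triangular arrays -/

section Arrays

variable {ι : Type*} {l : Filter ι} {T : ι → ℕ} {a b : ι → ℕ → ℝ} {f g : ℝ → ℝ}

/-- The arrays `a i t`, `1 ≤ t ≤ T i`, are uniformly close to `f (t / T i)` along `l`. -/
def UnifConv (l : Filter ι) (T : ι → ℕ) (a : ι → ℕ → ℝ) (f : ℝ → ℝ) : Prop :=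
  ∀ ε > 0, ∀ᶠ i in l, ∀ t ∈ Finset.Icc 1 (T i), |a i t - f (t / T i)| ≤ ε

theorem div_mem_unit {n t : ℕ} (ht : t ∈ Finset.Icc 1 n) : (t : ℝ) / n ∈ Icc (0 : ℝ) 1 := by
  obtain ⟨-, h⟩ := Finset.mem_Icc.1 ht
  exact ⟨by positivity, div_le_one_of_le₀ (by exact_mod_cast h) (by positivity)⟩

theorem exists_bound_unit (hf : Continuous f) : ∃ C, 0 < C ∧ ∀ r ∈ Icc (0 : ℝ) 1, |f r| ≤ C := by
  obtain ⟨C, hC⟩ := isCompact_Icc.exists_bound_of_continuousOn (hf.continuousOn (s := Icc 0 1))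
  exact ⟨max C 1, by positivity, fun r hr => (hC r hr).trans (le_max_left _ _)⟩

theorem UnifConv.congr (h : UnifConv l T a f)
    (hab : ∀ᶠ i in l, ∀ t ∈ Finset.Icc 1 (T i), a i t = b i t) : UnifConv l T b f := by
  intro ε hε
  filter_upwards [h ε hε, hab] with i h1 h2 t ht
  rw [← h2 t ht]
  exact h1 t ht

theorem UnifConv.add (ha : UnifConv l T a f) (hb : UnifConv l T b g) :
    UnifConv l T (fun i t => a i t + b i t) (fun r => f r + g r) := by
  intro ε hε
  filter_upwards [ha (ε / 2) (by positivity), hb (ε / 2) (by positivity)] with i h1 h2 t ht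
  have := h1 t ht
  have := h2 t ht
  rw [abs_le] at *
  constructor <;> linarith

theorem UnifConv.neg (ha : UnifConv l T a f) :
    UnifConv l T (fun i t => -a i t) (fun r => -f r) := by
  intro ε hε
  filter_upwards [ha ε hε] with i h1 t ht
  have := h1 t ht
  rw [abs_le] at *
  constructor <;> linarith

theorem UnifConv.sub (ha : UnifConv l T a f) (hb : UnifConv l T b g) :
    UnifConv l T (fun i t => a i t - b i t) (fun r => f r - g r) := by
  simpa only [sub_eq_add_neg] using ha.add hb.neg

theorem UnifConv.of_tendsto {s : ι → ℝ} {s₀ : ℝ} (hs : Tendsto s l (𝓝 s₀)) :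
    UnifConv l T (fun i _ => s i) (fun _ => s₀) := by
  intro ε hε
  filter_upwards [Metric.tendsto_nhds.1 hs ε hε] with i h1 t _
  exact (Real.dist_eq _ _ ▸ h1).le

theorem UnifConv.self (f : ℝ → ℝ) : UnifConv l T (fun i t => f (t / T i)) f := by
  intro ε hε
  filter_upwards with i t _
  simpa using hε.le

theorem UnifConv.mul (ha : UnifConv l T a f) (hb : UnifConv l T b g) (hf : Continuous f)
    (hg : Continuous g) : UnifConv l T (fun i t => a i t * b i t) (fun r => f r * g r) := by
  intro ε hε
  obtain ⟨C, hC, hfC⟩ := exists_bound_unit hf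
  obtain ⟨D, hD, hgD⟩ := exists_bound_unit hg
  have e1 : 0 < min 1 (ε / (2 * (C + 1))) := by positivity
  have e2 : 0 < min 1 (ε / (2 * D)) := by positivity
  filter_upwards [ha _ e2, hb _ e1] with i h1 h2 t ht
  have hr := div_mem_unit ht
  have ha' := h1 t ht
  have hb' := h2 t ht
  have hfr := hfC _ hr
  have hgr := hgD _ hr
  have haC : |a i t| ≤ C + 1 := by
    have : |a i t| ≤ |a i t - f (t / T i)| + |f (t / T i)| := by
      simpa using abs_add_le (a i t - f (t / T i)) (f (t / T i))
    linarith [ha'.trans (min_le_left _ _)]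
  have : a i t * b i t - f (t / T i) * g (t / T i) =
      a i t * (b i t - g (t / T i)) + (a i t - f (t / T i)) * g (t / T i) := by ring
  rw [this]
  calc _ ≤ |a i t| * |b i t - g (t / T i)| + |a i t - f (t / T i)| * |g (t / T i)| := by
        rw [← abs_mul, ← abs_mul]; exact abs_add_le _ _
    _ ≤ (C + 1) * (ε / (2 * (C + 1))) + ε / (2 * D) * D := by
        gcongr
        · exact hb'.trans (min_le_right _ _)
        · exact ha'.trans (min_le_right _ _)
    _ = ε := by field_simp; ring

theorem UnifConv.sum {κ : Type*} (s : Finset κ) {a : κ → ι → ℕ → ℝ} {f : κ → ℝ → ℝ}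
    (h : ∀ j ∈ s, UnifConv l T (a j) (f j)) :
    UnifConv l T (fun i t => ∑ j ∈ s, a j i t) (fun r => ∑ j ∈ s, f j r) := by
  classical
  induction s using Finset.induction_on with
  | empty => simpa using UnifConv.of_tendsto (l := l) (T := T) (tendsto_const_nhds (x := (0 : ℝ)))
  | insert j s hj ih =>
    simp only [Finset.sum_insert hj]
    exact (h j (Finset.mem_insert_self _ _)).add
      (ih fun j' hj' => h j' (Finset.mem_insert_of_mem hj'))

/-- Uniformly small oscillation of a continuous function over a mesh of size `1 / n`. -/
theorem exists_mesh (hf : Continuous f) {ε : ℝ} (hε : 0 < ε) :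
    ∃ N : ℕ, ∀ n ≥ N, 0 < n → ∀ r ∈ Icc (0 : ℝ) 1, ∀ s ∈ Icc (0 : ℝ) 1, |r - s| ≤ (n : ℝ)⁻¹ →
      |f r - f s| ≤ ε := by
  have huc := isCompact_Icc.uniformContinuousOn_of_continuous (hf.continuousOn (s := Icc (0 : ℝ) 1))
  obtain ⟨δ, hδ, h⟩ := Metric.uniformContinuousOn_iff.1 huc ε hε
  obtain ⟨N, hN⟩ := exists_nat_gt δ⁻¹
  refine ⟨N, fun n hn hn0 r hr s hs hrs => ?_⟩
  have hn0' : (0 : ℝ) < n := by exact_mod_cast hn0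
  have : (n : ℝ)⁻¹ < δ := by
    rw [inv_lt_comm₀ hn0' hδ]
    exact hN.trans_le (by exact_mod_cast hn)
  exact (Real.dist_eq _ _ ▸ h r hr s hs (Real.dist_eq r s ▸ hrs.trans_lt this)).le

theorem UnifConv.cumsum (hT : Tendsto T l atTop) (ha : UnifConv l T a f) (hf : Continuous f) :
    UnifConv l T (fun i t => (T i : ℝ)⁻¹ * ∑ s ∈ Finset.Icc 1 t, a i s)
      (fun r => ∫ s in (0 : ℝ)..r, f s) := by
  intro ε hε
  obtain ⟨N, hN⟩ := exists_mesh hf (half_pos hε)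
  filter_upwards [ha (ε / 2) (by positivity), hT.eventually_ge_atTop N,
    hT.eventually_gt_atTop 0] with i h1 h2 h3 t ht
  have h3' : (0 : ℝ) < T i := by exact_mod_cast h3
  suffices H : ∀ t ≤ T i, |(T i : ℝ)⁻¹ * ∑ s ∈ Finset.Icc 1 t, a i s -
      ∫ s in (0 : ℝ)..(t / T i), f s| ≤ ε * (t / T i) by
    refine (H t (Finset.mem_Icc.1 ht).2).trans ?_
    exact mul_le_of_le_one_right hε.le (div_mem_unit ht).2
  intro t ht
  induction t with
  | zero => simp
  | succ t ih =>
    have ih := ih (Nat.le_of_succ_le ht)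
    have hmem : t + 1 ∈ Finset.Icc 1 (T i) := Finset.mem_Icc.2 ⟨by omega, ht⟩
    have hi := fun x y => hf.intervalIntegrable (μ := volume) x y
    have hstep : ((t + 1 : ℕ) : ℝ) / T i - t / T i = (T i : ℝ)⁻¹ := by
      push_cast; field_simp; ring
    have hle : (t : ℝ) / T i ≤ (t + 1 : ℕ) / T i := by
      have := inv_pos.2 h3'
      linarith
    have hbound : |(∫ s in (t / T i : ℝ)..((t + 1 : ℕ) / T i), f s) -
        (T i : ℝ)⁻¹ * f ((t + 1 : ℕ) / T i)| ≤ ε / 2 * (T i : ℝ)⁻¹ := by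
      have e : (T i : ℝ)⁻¹ * f ((t + 1 : ℕ) / T i) =
          ∫ s in (t / T i : ℝ)..((t + 1 : ℕ) / T i), f ((t + 1 : ℕ) / T i) := by
        rw [intervalIntegral.integral_const, hstep, smul_eq_mul]
      rw [e, ← intervalIntegral.integral_sub (hi _ _) (by simp)]
      have := intervalIntegral.norm_integral_le_of_norm_le_const
        (f := fun s => f s - f ((t + 1 : ℕ) / T i)) (C := ε / 2)
        (a := (t / T i : ℝ)) (b := ((t + 1 : ℕ) / T i)) ?_
      · rwa [hstep, abs_of_pos (inv_pos.2 h3'), Real.norm_eq_abs] at this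
      · intro s hs
        rw [uIoc_of_le hle] at hs
        have h0 : (0 : ℝ) ≤ t / T i := by positivity
        have hu := div_mem_unit hmem
        refine hN _ h2 h3 s ⟨h0.trans hs.1.le, hs.2.trans hu.2⟩ _ hu ?_
        rw [abs_le]
        constructor <;> linarith [hs.1, hs.2]
    rw [Finset.sum_Icc_succ_top (by omega), mul_add,
      ← intervalIntegral.integral_add_adjacent_intervals (hi 0 (t / T i)) (hi _ _)]
    have hlast : |(T i : ℝ)⁻¹ * a i (t + 1) - (T i : ℝ)⁻¹ * f ((t + 1 : ℕ) / T i)| ≤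
        ε / 2 * (T i : ℝ)⁻¹ := by
      rw [← mul_sub, abs_mul, abs_of_pos (inv_pos.2 h3'), mul_comm]
      exact mul_le_mul_of_nonneg_right (h1 _ hmem) (by positivity)
    have e2 : ε * (((t + 1 : ℕ) : ℝ) / T i) = ε * (t / T i) + ε * (T i : ℝ)⁻¹ := by
      rw [← hstep]; ring
    rw [e2]
    rw [abs_le] at *
    constructor <;> linarith

theorem UnifConv.tendsto_mean (hT : Tendsto T l atTop) (ha : UnifConv l T a f)
    (hf : Continuous f) :
    Tendsto (fun i => (T i : ℝ)⁻¹ * ∑ s ∈ Finset.Icc 1 (T i), a i s) l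
      (𝓝 (∫ s in (0 : ℝ)..1, f s)) := by
  rw [Metric.tendsto_nhds]
  intro ε hε
  filter_upwards [ha.cumsum hT hf (ε / 2) (by positivity), hT.eventually_gt_atTop 0] with i h1 h2
  have := h1 (T i) (Finset.mem_Icc.2 ⟨h2, le_rfl⟩)
  rw [div_self (by positivity)] at this
  rw [Real.dist_eq]
  linarith

/-- Discrete Gronwall inequality. -/
theorem discrete_gronwall {n : ℕ} {d : ℕ → ℝ} {ε κ : ℝ} (hκ : 0 ≤ κ)
    (h : ∀ t ≤ n, d t ≤ ε + κ * ∑ s ∈ Finset.range t, d s) :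
    ∀ t ≤ n, d t ≤ ε * (1 + κ) ^ t := by
  intro t
  induction t using Nat.strong_induction_on with
  | _ t ih =>
    intro ht
    refine (h t ht).trans ?_
    have h1 : ∑ s ∈ Finset.range t, d s ≤ ∑ s ∈ Finset.range t, ε * (1 + κ) ^ s :=
      Finset.sum_le_sum fun s hs =>
        ih s (Finset.mem_range.1 hs) ((Finset.mem_range.1 hs).le.trans ht)
    have h2 : κ * ∑ s ∈ Finset.range t, (1 + κ) ^ s = (1 + κ) ^ t - 1 := by
      have := geom_sum_mul (1 + κ) t
      rw [add_sub_cancel_left] at this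
      rw [mul_comm, this]
    rw [← Finset.mul_sum] at h1
    calc _ ≤ ε + κ * (ε * ∑ s ∈ Finset.range t, (1 + κ) ^ s) := by gcongr
      _ = ε + ε * (κ * ∑ s ∈ Finset.range t, (1 + κ) ^ s) := by ring
      _ = _ := by rw [h2]; ring

/-- The Ornstein-Uhlenbeck transform `g(r) + c ∫_0^r e^{(r-s)c} g(s) ds` of a path `g`. -/
noncomputable def ouTransform (c : ℝ) (g : ℝ → ℝ) (r : ℝ) : ℝ :=
  g r + c * ∫ s in (0 : ℝ)..r, Real.exp ((r - s) * c) * g s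

theorem hasDerivAt_expConv (c : ℝ) (hg : Continuous g) (r : ℝ) :
    HasDerivAt (fun r => ∫ s in (0 : ℝ)..r, Real.exp ((r - s) * c) * g s)
      (ouTransform c g r) r := by
  have e : ∀ r : ℝ, ∫ s in (0 : ℝ)..r, Real.exp ((r - s) * c) * g s =
      Real.exp (r * c) * ∫ s in (0 : ℝ)..r, Real.exp (-s * c) * g s := by
    intro r
    rw [← intervalIntegral.integral_const_mul]
    congr 1
    ext s
    rw [← mul_assoc, ← Real.exp_add]
    ring_nf
  have hc : Continuous fun s => Real.exp (-s * c) * g s := by fun_prop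
  have h1 : HasDerivAt (fun r => ∫ s in (0 : ℝ)..r, Real.exp (-s * c) * g s)
      (Real.exp (-r * c) * g r) r := intervalIntegral.integral_hasDerivAt_right
    (hc.intervalIntegrable _ _) (hc.stronglyMeasurableAtFilter _ _) hc.continuousAt
  have h2 : HasDerivAt (fun r : ℝ => Real.exp (r * c)) (Real.exp (r * c) * c) r := by
    simpa using ((hasDerivAt_id r).mul_const c).exp
  have h3 := h2.mul h1
  unfold ouTransform
  rw [e]
  simp_rw [e]
  refine h3.congr_deriv ?_
  rw [← mul_assoc (Real.exp (r * c)) (Real.exp (-r * c)), ← Real.exp_add]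
  ring_nf
  simp

theorem continuous_ouTransform (c : ℝ) (hg : Continuous g) : Continuous (ouTransform c g) := by
  have : Continuous fun r => ∫ s in (0 : ℝ)..r, Real.exp ((r - s) * c) * g s :=
    continuous_iff_continuousAt.2 fun r => (hasDerivAt_expConv c hg r).continuousAt
  unfold ouTransform
  fun_prop

theorem integral_ouTransform (c : ℝ) (hg : Continuous g) (r : ℝ) :
    ∫ s in (0 : ℝ)..r, ouTransform c g s = ∫ s in (0 : ℝ)..r, Real.exp ((r - s) * c) * g s := by
  rw [intervalIntegral.integral_eq_sub_of_hasDerivAt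
    (f := fun r => ∫ s in (0 : ℝ)..r, Real.exp ((r - s) * c) * g s)
    (fun x _ => hasDerivAt_expConv c hg x)
    ((continuous_ouTransform c hg).intervalIntegrable _ _)]
  simp

theorem ouTransform_eq (c : ℝ) (hg : Continuous g) (r : ℝ) :
    ouTransform c g r = g r + c * ∫ s in (0 : ℝ)..r, ouTransform c g s := by
  rw [integral_ouTransform c hg, ouTransform]

theorem ouTransform_zero_left (g : ℝ → ℝ) : ouTransform 0 g = g := by
  ext r
  simp [ouTransform]

/-- A near-unit-root autoregression driven by an array converging to `g` converges to the
Ornstein-Uhlenbeck transform of `g`. -/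
theorem UnifConv.autoregression {c : ℝ} (hT : Tendsto T l atTop) (hg : Continuous g)
    (hg0 : g 0 = 0) {u S : ι → ℕ → ℝ}
    (hS : UnifConv l T S g) (hS0 : ∀ i, S i 0 = 0) (hu0 : Tendsto (fun i => u i 0) l (𝓝 0))
    (hu : ∀ i, ∀ t < T i, u i (t + 1) = (1 + c / T i) * u i t + (S i (t + 1) - S i t)) :
    UnifConv l T u (ouTransform c g) := by
  set J := ouTransform c g with hJ
  have hJc : Continuous J := continuous_ouTransform c hg
  have hJ0 : J 0 = 0 := by simp [hJ, ouTransform, hg0]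
  intro ε hε
  set C := Real.exp |c| with hC
  have hCpos : 0 < C := Real.exp_pos _
  set δ := ε / (C * (2 + 2 * |c|)) with hδ
  have hδpos : 0 < δ := by positivity
  have hRiem : UnifConv l T (fun i t => (T i : ℝ)⁻¹ * ∑ s ∈ Finset.Icc 1 t, J (s / T i))
      (fun r => ∫ s in (0 : ℝ)..r, J s) :=
    (UnifConv.self J).cumsum hT hJc
  obtain ⟨D, hD, hJD⟩ := exists_bound_unit hJc
  have hTinv : Tendsto (fun i => (T i : ℝ)⁻¹) l (𝓝 0) :=
    tendsto_inv_atTop_zero.comp (tendsto_natCast_atTop_atTop.comp hT)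
  filter_upwards [hS δ hδpos, hRiem δ hδpos, hT.eventually_gt_atTop 0,
    Metric.tendsto_nhds.1 hu0 δ hδpos,
    Metric.tendsto_nhds.1 hTinv (δ / D) (by positivity)] with i h1 h2 h3 h4 h5 t ht
  have h3' : (0 : ℝ) < T i := by exact_mod_cast h3
  rw [Real.dist_eq, sub_zero] at h4 h5
  rw [abs_of_pos (inv_pos.2 h3')] at h5
  have hsol : ∀ t ≤ T i,
      u i t = u i 0 + S i t + c * ((T i : ℝ)⁻¹ * ∑ s ∈ Finset.range t, u i s) := by
    intro t
    induction t with
    | zero => simp [hS0]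
    | succ t ih =>
      intro ht
      rw [hu i t (by omega), Finset.sum_range_succ]
      have := ih (by omega)
      linear_combination this
  have hkey : ∀ t ≤ T i, |u i t - J (t / T i)| ≤
      δ * (2 + 2 * |c|) + (|c| / T i) * ∑ s ∈ Finset.range t, |u i s - J (s / T i)| := by
    intro t ht
    rcases Nat.eq_zero_or_pos t with rfl | htpos
    · simp only [Nat.cast_zero, zero_div, hJ0, sub_zero, Finset.range_zero, Finset.sum_empty,
        mul_zero, add_zero]
      nlinarith [abs_nonneg c]
    have hmem : t ∈ Finset.Icc 1 (T i) := Finset.mem_Icc.2 ⟨htpos, ht⟩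
    have hr := div_mem_unit hmem
    have hshift : ∑ s ∈ Finset.range t, J (s / T i) =
        ∑ s ∈ Finset.Icc 1 t, J (s / T i) - J (t / T i) := by
      have e1 : ∑ s ∈ Finset.Icc 1 t, J (s / T i) + J 0 =
          ∑ s ∈ Finset.range (t + 1), J (s / T i) := by
        rw [Finset.sum_range_succ', Finset.range_eq_Ico,
          Finset.sum_Ico_add' (fun s : ℕ => J (s / T i)) 0 t 1]
        simp only [zero_add, Nat.cast_zero, zero_div]
        rfl
      rw [Finset.sum_range_succ, hJ0] at e1
      linarith
    have hJeq := ouTransform_eq c hg (t / T i)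
    rw [← hJ] at hJeq
    have hdec : u i t - J (t / T i) = u i 0 + (S i t - g (t / T i)) +
        c * ((T i : ℝ)⁻¹ * ∑ s ∈ Finset.Icc 1 t, J (s / T i) - ∫ s in (0 : ℝ)..(t / T i), J s) -
        c * ((T i : ℝ)⁻¹ * J (t / T i)) +
        c / T i * ∑ s ∈ Finset.range t, (u i s - J (s / T i)) := by
      rw [Finset.sum_sub_distrib, hshift, div_eq_mul_inv c]
      linear_combination hsol t ht - hJeq
    have hb1 : |(T i : ℝ)⁻¹ * J (t / T i)| ≤ δ := by
      rw [abs_mul, abs_of_pos (inv_pos.2 h3')]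
      calc _ ≤ δ / D * D := mul_le_mul h5.le (hJD _ hr) (abs_nonneg _) (by positivity)
        _ = δ := by field_simp
    have hb2 : |c / T i * ∑ s ∈ Finset.range t, (u i s - J (s / T i))| ≤
        (|c| / T i) * ∑ s ∈ Finset.range t, |u i s - J (s / T i)| := by
      rw [abs_mul, abs_div, abs_of_pos h3']
      gcongr
      exact Finset.abs_sum_le_sum_abs _ _
    have hb3 : |c * ((T i : ℝ)⁻¹ * ∑ s ∈ Finset.Icc 1 t, J (s / T i) -
        ∫ s in (0 : ℝ)..(t / T i), J s)| ≤ |c| * δ := by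
      rw [abs_mul]
      gcongr
      exact h2 t hmem
    have hb4 : |c * ((T i : ℝ)⁻¹ * J (t / T i))| ≤ |c| * δ := by
      rw [abs_mul]
      gcongr
    have hb5 := h1 t hmem
    rw [hdec]
    rw [abs_le] at *
    have h4' := abs_lt.1 h4
    constructor <;> linarith
  have := discrete_gronwall (n := T i) (d := fun t => |u i t - J (t / T i)|) (by positivity) hkey t
    (Finset.mem_Icc.1 ht).2
  refine this.trans ?_
  have hpow : (1 + |c| / T i) ^ t ≤ C := by
    calc _ ≤ (1 + |c| / T i) ^ T i :=
          pow_le_pow_right₀ (by linarith [show 0 ≤ |c| / T i by positivity]) (Finset.mem_Icc.1 ht).2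
      _ ≤ (Real.exp (|c| / T i)) ^ T i := by
          gcongr
          rw [add_comm]
          exact Real.add_one_le_exp _
      _ = C := by
          rw [← Real.exp_nat_mul, hC]
          congr 1
          field_simp
  calc _ ≤ δ * (2 + 2 * |c|) * C := by gcongr
    _ = ε := by rw [hδ]; field_simp

end Arrays

end VarianceRatio

namespace VarianceRatio

open Set Topology

/-! ### Algebra of least squares residuals -/

section Ols

variable {n : ℕ} {T : ℕ} {z z' : ℕ → ℝ} {q q' : ℕ → Fin n → ℝ}

/-- The Gram matrix of regressors observed at `t = 1, …, T`. -/
noncomputable def gram (T : ℕ) (q : ℕ → Fin n → ℝ) : Matrix (Fin n) (Fin n) ℝ :=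
  ∑ s ∈ Finset.Icc 1 T, Matrix.vecMulVec (q s) (q s)

/-- The cross moments of a series with regressors observed at `t = 1, …, T`. -/
noncomputable def crossMoment (T : ℕ) (z : ℕ → ℝ) (q : ℕ → Fin n → ℝ) : Fin n → ℝ :=
  ∑ s ∈ Finset.Icc 1 T, z s • q s

/-- Residuals of the least squares regression of `z` on `q`. -/
noncomputable def olsResid (T : ℕ) (z : ℕ → ℝ) (q : ℕ → Fin n → ℝ) (t : ℕ) : ℝ :=
  z t - q t ⬝ᵥ ((gram T q)⁻¹ *ᵥ crossMoment T z q)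

theorem olsDetrend_eq (k : DetCase) : olsDetrend k T z = olsResid T z k.d := rfl

theorem residual_eq (k : DetCase) (y : ℕ → ℝ) (x : ℕ → Fin n → ℝ) :
    residual k T y x = olsResid T (olsDetrend k T y) (detrendedX k T x) := rfl

theorem gram_congr (h : ∀ s ∈ Finset.Icc 1 T, q s = q' s) : gram T q = gram T q' :=
  Finset.sum_congr rfl fun s hs => by rw [h s hs]

theorem olsResid_congr (hz : ∀ s ∈ Finset.Icc 1 T, z s = z' s)
    (hq : ∀ s ∈ Finset.Icc 1 T, q s = q' s) {t : ℕ} (ht : t ∈ Finset.Icc 1 T) :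
    olsResid T z q t = olsResid T z' q' t := by
  unfold olsResid
  rw [hz t ht, hq t ht, gram_congr hq]
  congr 3
  exact Finset.sum_congr rfl fun s hs => by rw [hz s hs, hq s hs]

theorem olsResid_add (t : ℕ) :
    olsResid T (fun s => z s + z' s) q t = olsResid T z q t + olsResid T z' q t := by
  have : crossMoment T (fun s => z s + z' s) q = crossMoment T z q + crossMoment T z' q := by
    simp [crossMoment, add_smul, Finset.sum_add_distrib]
  unfold olsResid
  rw [this, Matrix.mulVec_add, dotProduct_add]
  ring

theorem olsResid_const_mul (c : ℝ) (t : ℕ) :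
    olsResid T (fun s => c * z s) q t = c * olsResid T z q t := by
  have : crossMoment T (fun s => c * z s) q = c • crossMoment T z q := by
    simp [crossMoment, mul_smul, Finset.smul_sum]
  unfold olsResid
  rw [this, Matrix.mulVec_smul, dotProduct_smul, smul_eq_mul]
  ring

theorem olsResid_sum {κ : Type*} (s : Finset κ) (z : κ → ℕ → ℝ) (t : ℕ) :
    olsResid T (fun r => ∑ j ∈ s, z j r) q t = ∑ j ∈ s, olsResid T (z j) q t := by
  classical
  induction s using Finset.induction_on with
  | empty =>
    have := olsResid_const_mul (T := T) (z := fun _ => 0) (q := q) 0 t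
    simpa using this
  | insert j s hj ih =>
    simp only [Finset.sum_insert hj]
    rw [olsResid_add, ih]

theorem olsResid_self (hG : (gram T q).det ≠ 0) (γ : Fin n → ℝ) (t : ℕ) :
    olsResid T (fun s => q s ⬝ᵥ γ) q t = 0 := by
  have : crossMoment T (fun s => q s ⬝ᵥ γ) q = gram T q *ᵥ γ := by
    unfold crossMoment gram
    rw [Matrix.sum_mulVec]
    refine Finset.sum_congr rfl fun s _ => ?_
    ext i
    simp only [Pi.smul_apply, smul_eq_mul, Matrix.mulVec, dotProduct, Matrix.vecMulVec_apply,
      Finset.sum_mul]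
    exact Finset.sum_congr rfl fun j _ => by ring
  unfold olsResid
  rw [this, Matrix.mulVec_mulVec, Matrix.nonsing_inv_mul _ (isUnit_iff_ne_zero.2 hG),
    Matrix.one_mulVec, sub_self]

theorem gram_mulVec (M : Matrix (Fin n) (Fin n) ℝ) :
    gram T (fun s => M *ᵥ q s) = M * gram T q * Mᵀ := by
  unfold gram
  rw [Finset.mul_sum, Finset.sum_mul]
  refine Finset.sum_congr rfl fun s _ => ?_
  rw [Matrix.mul_vecMulVec, Matrix.vecMulVec_mul, Matrix.vecMul_transpose]

/-- The change of regressors in the normal equations. -/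
theorem dotProduct_inv_change (M G : Matrix (Fin n) (Fin n) ℝ) (hM : M.det ≠ 0)
    (v b : Fin n → ℝ) :
    M *ᵥ v ⬝ᵥ ((M * G * Mᵀ)⁻¹ *ᵥ (M *ᵥ b)) = v ⬝ᵥ (G⁻¹ *ᵥ b) := by
  have hu : IsUnit M.det := isUnit_iff_ne_zero.2 hM
  rw [Matrix.mul_inv_rev, Matrix.mul_inv_rev, Matrix.mulVec_mulVec, Matrix.mul_assoc,
    Matrix.mul_assoc, Matrix.nonsing_inv_mul _ hu, Matrix.mul_one, ← Matrix.vecMul_transpose,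
    ← Matrix.dotProduct_mulVec, Matrix.mulVec_mulVec, ← Matrix.mul_assoc,
    Matrix.mul_nonsing_inv _ (by rwa [Matrix.det_transpose]), Matrix.one_mul]

theorem olsResid_mulVec (M : Matrix (Fin n) (Fin n) ℝ) (hM : M.det ≠ 0) (t : ℕ) :
    olsResid T z (fun s => M *ᵥ q s) t = olsResid T z q t := by
  have : crossMoment T z (fun s => M *ᵥ q s) = M *ᵥ crossMoment T z q := by
    unfold crossMoment
    rw [Matrix.mulVec_sum]
    exact Finset.sum_congr rfl fun s _ => (Matrix.mulVec_smul _ _ _).symm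
  unfold olsResid
  rw [gram_mulVec, this, dotProduct_inv_change M _ hM]

theorem olsResid_smul (c : ℝ) (hc : c ≠ 0) (t : ℕ) :
    olsResid T z (fun s => c • q s) t = olsResid T z q t := by
  have := olsResid_mulVec (T := T) (z := z) (q := q) (c • (1 : Matrix (Fin n) (Fin n) ℝ))
    (by rw [Matrix.det_smul, Matrix.det_one, mul_one]; exact pow_ne_zero _ hc) t
  rw [← this]
  simp only [Matrix.smul_mulVec, Matrix.one_mulVec]

theorem olsResid_normalized (hT : T ≠ 0) (t : ℕ) :
    olsResid T z q t = z t - q t ⬝ᵥ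
      (((T : ℝ)⁻¹ • gram T q)⁻¹ *ᵥ ((T : ℝ)⁻¹ • crossMoment T z q)) := by
  have hT' : (T : ℝ)⁻¹ ≠ 0 := by positivity
  have e : ((T : ℝ)⁻¹ • gram T q)⁻¹ = (T : ℝ) • (gram T q)⁻¹ := by
    by_cases hG : IsUnit (gram T q).det
    · have := Matrix.inv_smul' (gram T q) (Units.mk0 _ hT') hG
      simpa [Units.smul_def] using this
    · have hG' : ¬ IsUnit ((T : ℝ)⁻¹ • gram T q).det := by
        rw [Matrix.det_smul, IsUnit.mul_iff]
        exact fun h => hG h.2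
      rw [Matrix.nonsing_inv_apply_not_isUnit _ hG, Matrix.nonsing_inv_apply_not_isUnit _ hG',
        smul_zero]
  unfold olsResid
  rw [e, Matrix.smul_mulVec, Matrix.mulVec_smul, smul_smul, mul_inv_cancel₀ (by positivity),
    one_smul]

end Ols

/-! ### Limits of least squares residuals -/

section OlsLimit

variable {ι : Type*} {l : Filter ι} {T : ι → ℕ} {n : ℕ}

theorem tendsto_matrix_inv {A : ι → Matrix (Fin n) (Fin n) ℝ} {A₀ : Matrix (Fin n) (Fin n) ℝ}
    (h : Tendsto A l (𝓝 A₀)) (hA : A₀.det ≠ 0) : Tendsto (fun i => (A i)⁻¹) l (𝓝 A₀⁻¹) := by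
  have hdet : Tendsto (fun i => (A i).det) l (𝓝 A₀.det) :=
    (continuous_id.matrix_det.tendsto A₀).comp h
  have hadj : Tendsto (fun i => (A i).adjugate) l (𝓝 A₀.adjugate) :=
    (continuous_id.matrix_adjugate.tendsto A₀).comp h
  simp only [Matrix.inv_def, Ring.inverse_eq_inv']
  exact (hdet.inv₀ hA).smul hadj

/-- The Gram matrix of a vector of paths in `L²[0,1]`. -/
noncomputable def pathGram (g : ℝ → Fin n → ℝ) : Matrix (Fin n) (Fin n) ℝ :=
  Matrix.of fun i j => ∫ s in (0 : ℝ)..1, g s i * g s j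

theorem tendsto_gram (hT : Tendsto T l atTop) {q : ι → ℕ → Fin n → ℝ} {g : ℝ → Fin n → ℝ}
    (hg : ∀ j, Continuous fun r => g r j)
    (hq : ∀ j, UnifConv l T (fun i t => q i t j) (fun r => g r j)) :
    Tendsto (fun i => (T i : ℝ)⁻¹ • gram (T i) (q i)) l (𝓝 (pathGram g)) := by
  refine tendsto_pi_nhds.2 fun a => tendsto_pi_nhds.2 fun b => ?_
  have := ((hq a).mul (hq b) (hg a) (hg b)).tendsto_mean hT ((hg a).mul (hg b))
  refine this.congr fun i => ?_
  simp [gram, Matrix.sum_apply, Matrix.vecMulVec_apply]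

theorem eventually_gram_det_ne_zero (hT : Tendsto T l atTop) {q : ι → ℕ → Fin n → ℝ}
    {g : ℝ → Fin n → ℝ} (hg : ∀ j, Continuous fun r => g r j)
    (hq : ∀ j, UnifConv l T (fun i t => q i t j) (fun r => g r j))
    (hdet : (pathGram g).det ≠ 0) : ∀ᶠ i in l, (gram (T i) (q i)).det ≠ 0 := by
  have := (continuous_id.matrix_det.tendsto (pathGram g)).comp (tendsto_gram hT hg hq)
  filter_upwards [this.eventually_ne hdet] with i hi h0
  apply hi
  simp [h0]

theorem UnifConv.olsResid (hT : Tendsto T l atTop) {a : ι → ℕ → ℝ} {f : ℝ → ℝ}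
    (hf : Continuous f) (ha : UnifConv l T a f) {q : ι → ℕ → Fin n → ℝ} {g : ℝ → Fin n → ℝ}
    (hg : ∀ j, Continuous fun r => g r j)
    (hq : ∀ j, UnifConv l T (fun i t => q i t j) (fun r => g r j))
    (hdet : (pathGram g).det ≠ 0) :
    UnifConv l T (fun i => olsResid (T i) (a i) (q i)) (projectOut f g) := by
  have h1 := tendsto_matrix_inv (tendsto_gram hT hg hq) hdet
  have h2 : Tendsto (fun i => (T i : ℝ)⁻¹ • crossMoment (T i) (a i) (q i)) l
      (𝓝 fun j => ∫ s in (0 : ℝ)..1, g s j * f s) := by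
    refine tendsto_pi_nhds.2 fun j => ?_
    refine (((hq j).mul ha (hg j) hf).tendsto_mean hT ((hg j).mul hf)).congr fun i => ?_
    simp [crossMoment, mul_comm]
  have h3 : Tendsto (fun i => ((T i : ℝ)⁻¹ • gram (T i) (q i))⁻¹ *ᵥ
      ((T i : ℝ)⁻¹ • crossMoment (T i) (a i) (q i))) l
      (𝓝 ((pathGram g)⁻¹ *ᵥ fun j => ∫ s in (0 : ℝ)..1, g s j * f s)) := by
    have hc : Continuous fun p : Matrix (Fin n) (Fin n) ℝ × (Fin n → ℝ) => p.1 *ᵥ p.2 := by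
      fun_prop
    exact (hc.tendsto _).comp (h1.prodMk_nhds h2)
  have h4 := ha.sub (UnifConv.sum Finset.univ fun j _ => (hq j).mul
    (UnifConv.of_tendsto (tendsto_pi_nhds.1 h3 j)) (hg j) continuous_const)
  refine h4.congr ?_
  filter_upwards [hT.eventually_gt_atTop 0] with i hi t _
  rw [olsResid_normalized hi.ne']
  rfl

theorem continuous_projectOut {f : ℝ → ℝ} (hf : Continuous f) {g : ℝ → Fin n → ℝ}
    (hg : ∀ j, Continuous fun r => g r j) : Continuous (projectOut f g) := by
  have : Continuous g := continuous_pi hg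
  unfold projectOut
  fun_prop

end OlsLimit

/-! ### Detrending -/

section Detrend

/-- The limits `1, r, …` of the scaled deterministic regressors. -/
def trendPath (k : DetCase) (r : ℝ) : Fin k.dim → ℝ := fun j => r ^ (j : ℕ)

theorem continuous_trendPath (k : DetCase) (j : Fin k.dim) :
    Continuous fun r => trendPath k r j := by
  unfold trendPath; fun_prop

theorem integral_pow_mul_pow (a b : ℕ) :
    ∫ s in (0 : ℝ)..1, s ^ a * s ^ b = 1 / ((a + b : ℕ) + 1) := by
  simp_rw [← pow_add, integral_pow]
  simp

theorem pathGram_trendPath_one : pathGram (trendPath .D1) = (!![1] : Matrix (Fin 1) (Fin 1) ℝ) := by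
  ext i j
  change ∫ s in (0 : ℝ)..1, s ^ (i : ℕ) * s ^ (j : ℕ) = _
  rw [integral_pow_mul_pow]
  change Fin 1 at i
  change Fin 1 at j
  fin_cases i; fin_cases j; norm_num

theorem pathGram_trendPath_two :
    pathGram (trendPath .D2) = (!![1, 1 / 2; 1 / 2, 1 / 3] : Matrix (Fin 2) (Fin 2) ℝ) := by
  ext i j
  change ∫ s in (0 : ℝ)..1, s ^ (i : ℕ) * s ^ (j : ℕ) = _
  rw [integral_pow_mul_pow]
  change Fin 2 at i
  change Fin 2 at j
  fin_cases i <;> fin_cases j <;> norm_num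

theorem pathGram_trendPath_det (k : DetCase) : (pathGram (trendPath k)).det ≠ 0 := by
  cases k
  · have : IsEmpty (Fin DetCase.D0.dim) := inferInstanceAs (IsEmpty (Fin 0))
    rw [Matrix.det_isEmpty]
    exact one_ne_zero
  · rw [pathGram_trendPath_one]
    change (!![1] : Matrix (Fin 1) (Fin 1) ℝ).det ≠ 0
    simp
  · rw [pathGram_trendPath_two]
    change (!![1, 1 / 2; 1 / 2, 1 / 3] : Matrix (Fin 2) (Fin 2) ℝ).det ≠ 0
    rw [Matrix.det_fin_two_of]
    norm_num

theorem projectOut_trendPath (k : DetCase) (p : ℝ → ℝ) :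
    projectOut p (trendPath k) = detrendPath k p := by
  ext r
  change p r - trendPath k r ⬝ᵥ ((pathGram (trendPath k))⁻¹ *ᵥ
      fun i => ∫ s in (0 : ℝ)..1, trendPath k s i * p s) = _
  cases k
  · have : IsEmpty (Fin DetCase.D0.dim) := inferInstanceAs (IsEmpty (Fin 0))
    simp [dotProduct, detrendPath]
  · rw [pathGram_trendPath_one]
    have h : (!![1] : Matrix (Fin 1) (Fin 1) ℝ)⁻¹ = 1 := by
      rw [show (!![1] : Matrix (Fin 1) (Fin 1) ℝ) = 1 by ext i j; fin_cases i; fin_cases j; rfl]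
      simp
    change p r - (fun j : Fin 1 => r ^ (j : ℕ)) ⬝ᵥ ((!![1] : Matrix (Fin 1) (Fin 1) ℝ)⁻¹ *ᵥ
      fun i : Fin 1 => ∫ s in (0 : ℝ)..1, s ^ (i : ℕ) * p s) = _
    rw [h]
    simp [detrendPath, dotProduct]
  · rw [pathGram_trendPath_two]
    have h : (!![1, 1 / 2; 1 / 2, 1 / 3] : Matrix (Fin 2) (Fin 2) ℝ)⁻¹ = !![4, -6; -6, 12] := by
      apply Matrix.inv_eq_right_inv
      ext i j
      fin_cases i <;> fin_cases j <;> norm_num [Matrix.mul_apply, Fin.sum_univ_two]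
    change p r - (fun j : Fin 2 => r ^ (j : ℕ)) ⬝ᵥ
      ((!![1, 1 / 2; 1 / 2, 1 / 3] : Matrix (Fin 2) (Fin 2) ℝ)⁻¹ *ᵥ
      fun i : Fin 2 => ∫ s in (0 : ℝ)..1, s ^ (i : ℕ) * p s) = _
    rw [h]
    simp [detrendPath, dotProduct, Matrix.mulVec, Fin.sum_univ_two]
    ring

theorem continuous_detrendPath (k : DetCase) {p : ℝ → ℝ} (hp : Continuous p) :
    Continuous (detrendPath k p) := by
  rw [← projectOut_trendPath]
  exact continuous_projectOut hp (continuous_trendPath k)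

theorem d_eq_mulVec (k : DetCase) {T : ℕ} (hT : T ≠ 0) (s : ℕ) :
    k.d s = Matrix.diagonal (fun j : Fin k.dim => (T : ℝ) ^ (j : ℕ)) *ᵥ
      trendPath k ((s : ℝ) / T) := by
  ext j
  have : (T : ℝ) ≠ 0 := by exact_mod_cast hT
  simp only [Matrix.mulVec_diagonal, trendPath, DetCase.d, div_pow]
  field_simp

theorem det_trendScale_ne_zero (k : DetCase) {T : ℕ} (hT : T ≠ 0) :
    (Matrix.diagonal fun j : Fin k.dim => (T : ℝ) ^ (j : ℕ)).det ≠ 0 := by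
  rw [Matrix.det_diagonal]
  exact Finset.prod_ne_zero_iff.2 fun j _ => pow_ne_zero _ (by exact_mod_cast hT)

theorem olsDetrend_eq_trendPath (k : DetCase) {T : ℕ} (hT : T ≠ 0) (z : ℕ → ℝ) :
    olsDetrend k T z = olsResid T z fun s => trendPath k ((s : ℝ) / T) := by
  ext t
  rw [olsDetrend_eq, ← olsResid_mulVec (q := fun s : ℕ => trendPath k ((s : ℝ) / T)) _
      (det_trendScale_ne_zero k hT),
    ← funext fun s => d_eq_mulVec k hT s]

variable {ι : Type*} {l : Filter ι} {T : ι → ℕ}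

theorem UnifConv.olsDetrend (k : DetCase) (hT : Tendsto T l atTop) {a : ι → ℕ → ℝ} {f : ℝ → ℝ}
    (hf : Continuous f) (ha : UnifConv l T a f) :
    UnifConv l T (fun i => olsDetrend k (T i) (a i)) (detrendPath k f) := by
  rw [← projectOut_trendPath]
  refine (UnifConv.olsResid hT hf ha (continuous_trendPath k)
    (q := fun i s => trendPath k ((s : ℝ) / T i))
    (fun j => UnifConv.self fun r => trendPath k r j) (pathGram_trendPath_det k)).congr ?_
  filter_upwards [hT.eventually_gt_atTop 0] with i hi t _
  rw [olsDetrend_eq_trendPath k hi.ne']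

theorem eventually_gram_d_det_ne_zero (k : DetCase) (hT : Tendsto T l atTop) :
    ∀ᶠ i in l, (gram (T i) k.d).det ≠ 0 := by
  filter_upwards [eventually_gram_det_ne_zero hT (continuous_trendPath k)
    (q := fun i s => trendPath k ((s : ℝ) / T i))
    (fun j => UnifConv.self fun r => trendPath k r j) (pathGram_trendPath_det k),
    hT.eventually_gt_atTop 0] with i h1 h2
  have e : k.d = fun s : ℕ => Matrix.diagonal (fun j : Fin k.dim => (T i : ℝ) ^ (j : ℕ)) *ᵥ
      trendPath k ((s : ℝ) / T i) := funext fun s => d_eq_mulVec k h2.ne' s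
  rw [e, gram_mulVec, Matrix.det_mul, Matrix.det_mul, Matrix.det_transpose]
  have := det_trendScale_ne_zero k h2.ne'
  exact mul_ne_zero (mul_ne_zero this h1) this

end Detrend

end VarianceRatio

namespace VarianceRatio

open Set Topology

/-! ### Invariance of the statistic -/

section Invariance

variable {m T : ℕ} {k : DetCase}

theorem olsDetrend_congr {z z' : ℕ → ℝ} (h : ∀ s ∈ Finset.Icc 1 T, z s = z' s) {t : ℕ}
    (ht : t ∈ Finset.Icc 1 T) : olsDetrend k T z t = olsDetrend k T z' t :=
  olsResid_congr h (fun _ _ => rfl) ht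

theorem detrendedX_of_eq_add (hD : (gram T k.d).det ≠ 0) {x X : ℕ → Fin m → ℝ}
    {γ : Fin m → Fin k.dim → ℝ}
    (hx : ∀ t ∈ Finset.Icc 1 T, ∀ j, x t j = X t j + k.d t ⬝ᵥ γ j) {t : ℕ}
    (ht : t ∈ Finset.Icc 1 T) : detrendedX k T x t = detrendedX k T X t := by
  ext j
  change olsDetrend k T (fun s => x s j) t = olsDetrend k T (fun s => X s j) t
  rw [olsDetrend_congr (z' := fun s => X s j + k.d s ⬝ᵥ γ j) (fun s hs => hx s hs j) ht,
    olsDetrend_eq, olsResid_add, olsResid_self hD, add_zero]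
  rfl

theorem residual_of_eq_add (hD : (gram T k.d).det ≠ 0) {x X : ℕ → Fin m → ℝ} {y u : ℕ → ℝ}
    {γ : Fin m → Fin k.dim → ℝ} {τ : Fin k.dim → ℝ} {β : Fin m → ℝ}
    (hG : (gram T (detrendedX k T X)).det ≠ 0)
    (hx : ∀ t ∈ Finset.Icc 1 T, ∀ j, x t j = X t j + k.d t ⬝ᵥ γ j)
    (hy : ∀ t ∈ Finset.Icc 1 T, y t = k.d t ⬝ᵥ τ + x t ⬝ᵥ β + u t) {t : ℕ}
    (ht : t ∈ Finset.Icc 1 T) : residual k T y x t = residual k T u X t := by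
  have hdx := fun s hs => detrendedX_of_eq_add (t := s) hD hx hs
  have hdy : ∀ s ∈ Finset.Icc 1 T, olsDetrend k T y s =
      detrendedX k T X s ⬝ᵥ β + olsDetrend k T u s := by
    intro s hs
    rw [olsDetrend_congr (z' := fun r => k.d r ⬝ᵥ τ + (∑ j, β j * x r j + u r))
      (fun r hr => by rw [hy r hr, add_assoc, dotProduct_comm (x r)]; rfl) hs, olsDetrend_eq,
      olsResid_add, olsResid_add, olsResid_self hD, olsResid_sum, zero_add, ← hdx s hs]
    congr 1
    rw [dotProduct_comm]
    exact Finset.sum_congr rfl fun j _ => olsResid_const_mul (z := fun r => x r j) _ _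
  rw [residual_eq, residual_eq, olsResid_congr hdy hdx ht, olsResid_add, olsResid_self hG, zero_add]

theorem VR_congr_residual {x x' : ℕ → Fin m → ℝ} {y y' : ℕ → ℝ}
    (h : ∀ t ∈ Finset.Icc 1 T, residual k T y x t = residual k T y' x' t) :
    VR k T y x = VR k T y' x' := by
  unfold VR
  congr 1
  · congr 1
    refine Finset.sum_congr rfl fun t ht => ?_
    rw [Finset.sum_congr rfl fun s hs => h s ?_]
    rw [Finset.mem_Icc] at *
    omega
  · exact Finset.sum_congr rfl fun t ht => by rw [h t ht]

theorem detrendedX_const_mul (c : ℝ) (X : ℕ → Fin m → ℝ) :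
    detrendedX k T (fun t j => c * X t j) = fun t => c • detrendedX k T X t := by
  ext t j
  exact olsResid_const_mul (z := fun s => X s j) c t

theorem VR_const_mul {c : ℝ} (hc : c ≠ 0) (u : ℕ → ℝ) (X : ℕ → Fin m → ℝ) :
    VR k T (fun t => c * u t) (fun t j => c * X t j) = VR k T u X := by
  have hr : ∀ t, residual k T (fun t => c * u t) (fun t j => c * X t j) t =
      c * residual k T u X t := by
    intro t
    rw [residual_eq, residual_eq, detrendedX_const_mul, olsResid_smul c hc, ← olsResid_const_mul]
    congr 1
    ext s
    exact olsResid_const_mul c s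
  unfold VR
  simp_rw [hr, ← Finset.mul_sum, mul_pow, ← Finset.mul_sum]
  rw [mul_left_comm, mul_div_mul_left _ _ (pow_ne_zero 2 hc)]

theorem gram_detrendedX_const_mul {c : ℝ} (X : ℕ → Fin m → ℝ)
    (h : (gram T (detrendedX k T fun t j => c * X t j)).det ≠ 0) :
    (gram T (detrendedX k T X)).det ≠ 0 := by
  rw [detrendedX_const_mul] at h
  have e : gram T (fun t => c • detrendedX k T X t) = (c * c) • gram T (detrendedX k T X) := by
    unfold gram
    rw [Finset.smul_sum]
    refine Finset.sum_congr rfl fun s _ => ?_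
    rw [Matrix.smul_vecMulVec, Matrix.vecMulVec_smul, smul_smul]
  rw [e, Matrix.det_smul] at h
  exact right_ne_zero_of_mul h

end Invariance

/-! ### Nondegenerate paths -/

section Nondegenerate

variable {m : ℕ}

/-- No nontrivial linear combination of the components of the path is `O(t)` on `[0,1]`. -/
def RoughPath {κ : Type*} [Fintype κ] (z : ℝ → κ → ℝ) : Prop :=
  ∀ a : κ → ℝ, (∃ C, ∀ t ∈ Icc (0 : ℝ) 1, |a ⬝ᵥ z t| ≤ C * t) → a = 0

theorem eq_zero_of_integral_sq {f : ℝ → ℝ} (hf : Continuous f)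
    (h : ∫ s in (0 : ℝ)..1, f s ^ 2 = 0) : ∀ r ∈ Icc (0 : ℝ) 1, f r = 0 := by
  intro r hr
  by_contra hne
  have := intervalIntegral.integral_pos (f := fun s => f s ^ 2) zero_lt_one
    (hf.pow 2).continuousOn (fun s _ => sq_nonneg _) ⟨r, hr, by positivity⟩
  exact this.ne' h

theorem integral_finsetSum_of_continuous {κ : Type*} (s : Finset κ) {f : κ → ℝ → ℝ}
    (hf : ∀ j ∈ s, Continuous (f j)) (a b : ℝ) :
    ∫ t in a..b, ∑ j ∈ s, f j t = ∑ j ∈ s, ∫ t in a..b, f j t :=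
  intervalIntegral.integral_finsetSum fun j hj => (hf j hj).intervalIntegrable _ _

theorem exists_combination_of_pathGram_det_eq_zero {g : ℝ → Fin m → ℝ}
    (hg : ∀ j, Continuous fun r => g r j) (h : (pathGram g).det = 0) :
    ∃ a : Fin m → ℝ, a ≠ 0 ∧ ∀ r ∈ Icc (0 : ℝ) 1, a ⬝ᵥ g r = 0 := by
  obtain ⟨a, ha, hGa⟩ := Matrix.exists_mulVec_eq_zero_iff.2 h
  refine ⟨a, ha, eq_zero_of_integral_sq (by unfold dotProduct; fun_prop) ?_⟩
  have hi : ∀ i j, Continuous fun s => a i * (g s i * g s j * a j) := by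
    intro i j
    have := hg i
    have := hg j
    fun_prop
  have : a ⬝ᵥ (pathGram g *ᵥ a) = ∫ s in (0 : ℝ)..1, (a ⬝ᵥ g s) ^ 2 := by
    have e : ∀ s, (a ⬝ᵥ g s) ^ 2 = ∑ i, ∑ j, a i * (g s i * g s j * a j) := by
      intro s
      rw [sq, dotProduct, Finset.sum_mul_sum]
      exact Finset.sum_congr rfl fun i _ => Finset.sum_congr rfl fun j _ => by ring
    simp_rw [e]
    rw [integral_finsetSum_of_continuous _ fun i _ => continuous_finsetSum _ fun j _ => hi i j]
    refine Finset.sum_congr rfl fun i _ => ?_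
    rw [integral_finsetSum_of_continuous _ fun j _ => hi i j, Matrix.mulVec, dotProduct,
      Finset.mul_sum]
    refine Finset.sum_congr rfl fun j _ => ?_
    rw [intervalIntegral.integral_const_mul, intervalIntegral.integral_mul_const]
    rfl
  rw [← this, hGa, dotProduct_zero]

theorem detrendPath_linear (k : DetCase) {κ : Type*} (s : Finset κ) (a : κ → ℝ) {p : κ → ℝ → ℝ}
    (hp : ∀ j, Continuous (p j)) (r : ℝ) :
    detrendPath k (fun r => ∑ j ∈ s, a j * p j r) r = ∑ j ∈ s, a j * detrendPath k (p j) r := by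
  have e1 : ∫ t in (0 : ℝ)..1, ∑ j ∈ s, a j * p j t =
      ∑ j ∈ s, a j * ∫ t in (0 : ℝ)..1, p j t := by
    rw [integral_finsetSum_of_continuous _ fun j _ => by have := hp j; fun_prop]
    simp
  have e2 : ∫ t in (0 : ℝ)..1, t * ∑ j ∈ s, a j * p j t =
      ∑ j ∈ s, a j * ∫ t in (0 : ℝ)..1, t * p j t := by
    simp_rw [Finset.mul_sum, mul_left_comm _ (a _)]
    rw [integral_finsetSum_of_continuous _ fun j _ => by have := hp j; fun_prop]
    simp
  cases k
  · rfl
  · simp only [detrendPath, e1, mul_sub, Finset.sum_sub_distrib]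
  · simp only [detrendPath, smul_eq_mul, e1, e2, mul_sub, Finset.sum_sub_distrib]
    rw [Finset.mul_sum, Finset.mul_sum]
    simp_rw [mul_left_comm (a _)]

theorem detrendPath_apply (k : DetCase) {q : ℝ → Fin m → ℝ} (hq : Continuous q) (r : ℝ)
    (j : Fin m) : detrendPath k q r j = detrendPath k (fun s => q s j) r := by
  have h1 : (∫ s in (0 : ℝ)..1, q s) j = ∫ s in (0 : ℝ)..1, q s j := by
    have := (ContinuousLinearMap.proj (R := ℝ) (φ := fun _ : Fin m => ℝ) j).intervalIntegral_comp_comm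
      (hq.intervalIntegrable (μ := volume) 0 1)
    exact this.symm
  have h2 : (∫ s in (0 : ℝ)..1, s • q s) j = ∫ s in (0 : ℝ)..1, s * q s j := by
    have := (ContinuousLinearMap.proj (R := ℝ) (φ := fun _ : Fin m => ℝ) j).intervalIntegral_comp_comm
      ((continuous_id.smul hq).intervalIntegrable (μ := volume) 0 1)
    exact this.symm
  cases k
  · rfl
  · simp [detrendPath, h1]
  · simp [detrendPath, h1, h2]

/-- A path starting at `0` whose detrended version vanishes is `O(t)`. -/
theorem linear_bound_of_detrendPath_eq_zero (k : DetCase) {p : ℝ → ℝ} (hp0 : p 0 = 0)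
    (h : ∀ r ∈ Icc (0 : ℝ) 1, detrendPath k p r = 0) :
    ∃ C, ∀ r ∈ Icc (0 : ℝ) 1, |p r| ≤ C * r := by
  have h0 := h 0 ⟨le_rfl, zero_le_one⟩
  cases k
  · exact ⟨0, fun r hr => by simpa [detrendPath] using h r hr⟩
  · refine ⟨0, fun r hr => ?_⟩
    have := h r hr
    simp only [detrendPath, hp0] at this h0
    rw [show p r = 0 by linarith]
    simp
  · set A := ∫ s in (0 : ℝ)..1, p s with hA
    set B := ∫ s in (0 : ℝ)..1, s • p s with hB
    refine ⟨|12 * B - 6 * A|, fun r hr => ?_⟩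
    have := h r hr
    simp only [detrendPath, hp0, smul_eq_mul] at this h0
    rw [← abs_of_nonneg hr.1, ← abs_mul, abs_of_nonneg hr.1]
    refine le_of_eq (congrArg _ ?_)
    simp only [smul_eq_mul] at hB
    rw [← hA, ← hB] at this h0
    linear_combination this - h0

/-- The limit of the variance ratio statistic as a functional of the limit path `z` of the
partial sums of `[ξ_t, v_t']'`. -/
noncomputable def limitFunctional (k : DetCase) (c : ℝ) (z : ℝ → Idx m → ℝ) : ℝ :=
  ratioFunctional (projectOut (detrendPath k (ouTransform c fun r => z r (.inl ())))
    (detrendPath k fun r j => z r (.inr j)))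

variable {z : ℝ → Idx m → ℝ}

theorem continuous_detrendPath_apply (k : DetCase) (hz : ∀ i, Continuous fun r => z r i)
    (j : Fin m) : Continuous fun r => detrendPath k (fun r (j : Fin m) => z r (.inr j)) r j := by
  simp_rw [detrendPath_apply k (continuous_pi fun j => hz (.inr j))]
  exact continuous_detrendPath k (hz _)

theorem RoughPath.eq_zero_of_detrendPath (k : DetCase) (c : ℝ) (h : RoughPath z)
    (hz : ∀ i, Continuous fun r => z r i) (hz0 : z 0 = 0) (b : ℝ) (a : Fin m → ℝ)
    (hab : ∀ r ∈ Icc (0 : ℝ) 1, b * detrendPath k (ouTransform c fun r => z r (.inl ())) r +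
      a ⬝ᵥ detrendPath k (fun r j => z r (.inr j)) r = 0) : b = 0 ∧ a = 0 := by
  set J := ouTransform c fun r => z r (.inl ()) with hJ
  have hJc : Continuous J := continuous_ouTransform c (hz _)
  have hJ0 : J 0 = 0 := by simp [hJ, ouTransform, hz0]
  set p : Idx m → ℝ → ℝ := Sum.elim (fun _ => J) (fun j r => z r (.inr j)) with hp
  have hpc : ∀ i, Continuous (p i) := by
    rintro (i | j)
    · exact hJc
    · exact hz _
  set α : Idx m → ℝ := Sum.elim (fun _ => b) a with hα
  have hdet : ∀ r ∈ Icc (0 : ℝ) 1, detrendPath k (fun r => ∑ i, α i * p i r) r = 0 := by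
    intro r hr
    rw [detrendPath_linear k _ α hpc, Fintype.sum_sum_type]
    refine Eq.trans ?_ (hab r hr)
    simp only [hα, hp, Sum.elim_inl, Sum.elim_inr, Finset.univ_unique, Finset.sum_singleton]
    congr 1
    exact Finset.sum_congr rfl fun j _ => by
      rw [detrendPath_apply k (continuous_pi fun j => hz (.inr j))]
  obtain ⟨C, hC⟩ := linear_bound_of_detrendPath_eq_zero k
    (by simp [hp, Fintype.sum_sum_type, hJ0, hz0]) hdet
  obtain ⟨D, hD, hJD⟩ := exists_bound_unit hJc
  have hα0 : α = 0 := by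
    refine h α ⟨C + |b| * (|c| * D), fun r hr => ?_⟩
    have e : α ⬝ᵥ z r = ∑ i, α i * p i r - b * (c * ∫ s in (0 : ℝ)..r, J s) := by
      have := ouTransform_eq c (hz (.inl ())) r
      rw [← hJ] at this
      simp only [dotProduct, Fintype.sum_sum_type, hα, hp, Sum.elim_inl, Sum.elim_inr,
        Finset.univ_unique, Finset.sum_singleton]
      linear_combination -b * this
    have hi : |∫ s in (0 : ℝ)..r, J s| ≤ D * r := by
      have := intervalIntegral.norm_integral_le_of_norm_le_const (f := J) (C := D)
        (a := 0) (b := r) fun s hs => by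
          rw [uIoc_of_le hr.1] at hs
          exact hJD s ⟨hs.1.le, hs.2.trans hr.2⟩
      rwa [sub_zero, abs_of_nonneg hr.1] at this
    rw [e]
    calc _ ≤ |∑ i, α i * p i r| + |b * (c * ∫ s in (0 : ℝ)..r, J s)| := abs_sub _ _
      _ ≤ C * r + |b| * (|c| * (D * r)) := by
          rw [abs_mul, abs_mul]
          gcongr
          exact hC r hr
      _ = _ := by ring
  exact ⟨congrFun hα0 (.inl ()), funext fun j => congrFun hα0 (.inr j)⟩

theorem RoughPath.pathGram_det_ne_zero (k : DetCase) (h : RoughPath z)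
    (hz : ∀ i, Continuous fun r => z r i) (hz0 : z 0 = 0) :
    (pathGram (detrendPath k fun r (j : Fin m) => z r (.inr j))).det ≠ 0 := by
  intro h0
  obtain ⟨a, ha, h0⟩ := exists_combination_of_pathGram_det_eq_zero
    (continuous_detrendPath_apply k hz) h0
  exact ha (h.eq_zero_of_detrendPath k 0 hz hz0 0 a fun r hr => by simpa using h0 r hr).2

theorem RoughPath.integral_sq_ne_zero (k : DetCase) (c : ℝ) (h : RoughPath z)
    (hz : ∀ i, Continuous fun r => z r i) (hz0 : z 0 = 0) :
    ∫ r in (0 : ℝ)..1, projectOut (detrendPath k (ouTransform c fun r => z r (.inl ())))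
      (detrendPath k fun r (j : Fin m) => z r (.inr j)) r ^ 2 ≠ 0 := by
  intro h0
  have h1 := eq_zero_of_integral_sq (continuous_projectOut
    (continuous_detrendPath k (continuous_ouTransform c (hz (.inl ()))))
    (continuous_detrendPath_apply k hz)) h0
  set q : ℝ → Fin m → ℝ := detrendPath k fun r (j : Fin m) => z r (.inr j)
  set p : ℝ → ℝ := detrendPath k (ouTransform c fun r => z r (.inl ()))
  refine one_ne_zero (h.eq_zero_of_detrendPath k c hz hz0 1
    (-((pathGram q)⁻¹ *ᵥ fun i => ∫ s in (0 : ℝ)..1, q s i * p s)) fun r hr => ?_).1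
  rw [neg_dotProduct, dotProduct_comm, one_mul, ← sub_eq_add_neg]
  exact h1 r hr

/-- The variance ratio statistic converges along arrays whose scaled partial sums converge
uniformly to a continuous rough path. -/
theorem tendsto_VR {ι : Type*} {l : Filter ι} {T : ι → ℕ} (hT : Tendsto T l atTop) (k : DetCase)
    (c : ℝ) (h : RoughPath z) (hz : ∀ i, Continuous fun r => z r i) (hz0 : z 0 = 0)
    {s : ι → ℝ} (hs : ∀ᶠ i in l, s i ≠ 0) {X : ι → ℕ → Idx m → ℝ} (hX0 : ∀ i, X i 0 = 0)
    (hX : ∀ j, UnifConv l T (fun i t => s i * X i t j) fun r => z r j)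
    {u : ι → ℕ → ℝ} (hu0 : Tendsto (fun i => s i * u i 0) l (𝓝 0))
    (hu : ∀ i, ∀ t < T i, u i (t + 1) =
      (1 + c / T i) * u i t + (X i (t + 1) (.inl ()) - X i t (.inl ())))
    {x : ι → ℕ → Fin m → ℝ}
    (hx : ∀ i, ∃ γ : Fin m → Fin k.dim → ℝ, ∀ t ∈ Finset.Icc 1 (T i), ∀ j,
      x i t j = X i t (.inr j) + k.d t ⬝ᵥ γ j)
    {y : ι → ℕ → ℝ} {τ : Fin k.dim → ℝ} {β : Fin m → ℝ}
    (hy : ∀ i, ∀ t ∈ Finset.Icc 1 (T i), y i t = k.d t ⬝ᵥ τ + x i t ⬝ᵥ β + u i t) :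
    Tendsto (fun i => VR k (T i) (y i) (x i)) l (𝓝 (limitFunctional k c z)) := by
  set g : ℝ → ℝ := projectOut (detrendPath k (ouTransform c fun r => z r (.inl ())))
    (detrendPath k fun r (j : Fin m) => z r (.inr j)) with hg
  have hJc := continuous_ouTransform c (hz (.inl ()))
  have hgc : Continuous g := continuous_projectOut (continuous_detrendPath k hJc)
    (continuous_detrendPath_apply k hz)
  have hau : UnifConv l T (fun i t => s i * u i t) (ouTransform c fun r => z r (.inl ())) :=
    UnifConv.autoregression hT (hz _) (congrFun hz0 _) (hX (.inl ()))
      (fun i => by simp [hX0]) hu0 fun i t ht => by rw [hu i t ht]; ring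
  have hdx : ∀ j, UnifConv l T
      (fun i t => detrendedX k (T i) (fun t (j : Fin m) => s i * X i t (.inr j)) t j)
      (fun r => detrendPath k (fun r (j : Fin m) => z r (.inr j)) r j) := by
    intro j
    simp_rw [detrendPath_apply k (continuous_pi fun j => hz (.inr j))]
    exact UnifConv.olsDetrend k hT (hz _) (hX (.inr j))
  have hdet := h.pathGram_det_ne_zero k hz hz0
  have hres : UnifConv l T (fun i => residual k (T i) (fun t => s i * u i t)
      (fun t (j : Fin m) => s i * X i t (.inr j))) g :=
    UnifConv.olsResid hT (continuous_detrendPath k hJc) (hau.olsDetrend k hT hJc)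
      (continuous_detrendPath_apply k hz) hdx hdet
  have hcum := hres.cumsum hT hgc
  have hic : Continuous fun r => ∫ s in (0 : ℝ)..r, g s :=
    intervalIntegral.continuous_primitive (fun a b => hgc.intervalIntegrable a b) 0
  have hnum := (hcum.mul hcum hic hic).tendsto_mean hT (hic.mul hic)
  have hden := (hres.mul hres hgc hgc).tendsto_mean hT (hgc.mul hgc)
  simp_rw [← sq] at hnum hden
  refine (hnum.div hden (h.integral_sq_ne_zero k c hz hz0)).congr' ?_
  filter_upwards [hs, hT.eventually_gt_atTop 0, eventually_gram_d_det_ne_zero k hT,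
    eventually_gram_det_ne_zero hT (continuous_detrendPath_apply k hz) hdx hdet] with
    i hsi hTi hDi hGi
  obtain ⟨γ, hγ⟩ := hx i
  have hT0 : (T i : ℝ) ≠ 0 := by positivity
  rw [VR_congr_residual fun t ht => residual_of_eq_add hDi
    (gram_detrendedX_const_mul (fun t j => X i t (.inr j)) hGi) hγ (hy i) ht,
    ← VR_const_mul hsi, VR]
  simp_rw [mul_pow, ← Finset.mul_sum]
  rw [Pi.div_apply, mul_div_mul_left _ _ (inv_ne_zero hT0), inv_pow]

end Nondegenerate

end VarianceRatio

namespace VarianceRatio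

open Set Topology

/-! ### The limit variables as functionals of Brownian paths -/

theorem tendsto_nat_mul_exp_sub_one (a : ℝ) :
    Tendsto (fun n : ℕ => (n : ℝ) * (Real.exp (a * (n : ℝ)⁻¹) - 1)) atTop (𝓝 a) := by
  have hd : HasDerivAt (fun x : ℝ => Real.exp (a * x)) a 0 := by
    simpa using ((hasDerivAt_id (0 : ℝ)).const_mul a).exp
  have hn : Tendsto (fun n : ℕ => (n : ℝ)⁻¹) atTop (𝓝[>] 0) :=
    tendsto_inv_atTop_nhdsGT_zero.comp tendsto_natCast_atTop_atTop
  refine (hd.tendsto_slope_zero_right.comp hn).congr fun n => ?_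
  simp

theorem pathIntegral_exp_eq (c : ℝ) {g : ℝ → ℝ} (hg : Continuous g) (hg0 : g 0 = 0) (r : ℝ) :
    pathIntegral (fun s => Real.exp ((r - s) * c)) g 0 r = ouTransform c g r := by
  refine Tendsto.limUnder_eq ?_
  set f : ℝ → ℝ := fun s => Real.exp ((r - s) * c) * g s with hf
  have hfc : Continuous f := by fun_prop
  have hfr : Continuous fun s => f (r * s) := by fun_prop
  have hmean := (UnifConv.self (l := atTop) (T := fun n : ℕ => n)
    (fun s => f (r * s))).tendsto_mean tendsto_id hfr
  have hlim := ((tendsto_nat_mul_exp_sub_one (r * c)).mul hmean).const_add (g r)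
  have e : g r + r * c * ∫ s in (0 : ℝ)..1, f (r * s) = ouTransform c g r := by
    have := intervalIntegral.mul_integral_comp_mul_left (f := f) (a := 0) (b := 1) r
    rw [mul_zero, mul_one] at this
    rw [ouTransform, ← this]
    ring
  rw [e] at hlim
  refine hlim.congr' ?_
  filter_upwards [eventually_gt_atTop 0] with n hn
  have hn' : (n : ℝ) ≠ 0 := by positivity
  have key : ∀ j : ℕ, ∑ i ∈ Finset.range j, Real.exp ((r - (0 + (r - 0) * (i / n))) * c) *
      (g (0 + (r - 0) * ((i + 1) / n)) - g (0 + (r - 0) * (i / n))) =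
      f (r * (j / n)) + (Real.exp (r * c * (n : ℝ)⁻¹) - 1) *
        ∑ t ∈ Finset.Icc 1 j, f (r * (t / n)) := by
    intro j
    induction j with
    | zero => simp [hf, hg0]
    | succ j ih =>
      rw [Finset.sum_range_succ, ih, Finset.sum_Icc_succ_top (by omega)]
      have e1 : Real.exp ((r - r * (j / n)) * c) =
          Real.exp ((r - r * ((j + 1 : ℕ) / n)) * c) * Real.exp (r * c * (n : ℝ)⁻¹) := by
        rw [← Real.exp_add]
        congr 1
        push_cast
        field_simp
        ring
      simp only [hf, zero_add, sub_zero]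
      push_cast at e1 ⊢
      rw [e1]
      ring
  rw [key n, div_self hn', mul_one]
  simp only [hf, sub_self, zero_mul, Real.exp_zero, one_mul, id_eq]
  field_simp

section Limit

variable {Ω' : Type*} {m : ℕ}

/-- The path `r ↦ A W(r)` on the real line. -/
noncomputable def linPath (A : Matrix (Idx m) (Idx m) ℝ) (W : Idx m → ℝ≥0 → Ω' → ℝ) (ω : Ω')
    (r : ℝ) : Idx m → ℝ :=
  A *ᵥ fun i => W i r.toNNReal ω

theorem continuous_linPath {A : Matrix (Idx m) (Idx m) ℝ} {W : Idx m → ℝ≥0 → Ω' → ℝ} {ω : Ω'}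
    (hW : ∀ i, Continuous fun t => W i t ω) (j : Idx m) : Continuous fun r => linPath A W ω r j := by
  have h : ∀ i, Continuous fun r : ℝ => W i r.toNNReal ω := fun i =>
    (hW i).comp continuous_real_toNNReal
  unfold linPath Matrix.mulVec dotProduct
  fun_prop

theorem linPath_zero {A : Matrix (Idx m) (Idx m) ℝ} {W : Idx m → ℝ≥0 → Ω' → ℝ} {ω : Ω'}
    (hW : ∀ i, W i 0 ω = 0) : linPath A W ω 0 = 0 := by
  have : (fun i => W i (Real.toNNReal 0) ω) = 0 := by
    ext i
    simp [hW]
  rw [linPath, this, Matrix.mulVec_zero]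

/-- The loading matrix of `[driver, W_v']'` on `W`. -/
noncomputable def driverMatrix (m : ℕ) (R2 : ℝ) : Matrix (Idx m) (Idx m) ℝ :=
  Matrix.fromBlocks 1 (Matrix.of fun _ _ => √(R2 / (1 - R2)) * (√(m : ℝ))⁻¹) 0 1

theorem linPath_driverMatrix (R2 : ℝ) (W : Idx m → ℝ≥0 → Ω' → ℝ) (ω : Ω') (r : ℝ) :
    linPath (driverMatrix m R2) W ω r =
      Sum.elim (fun _ => driver R2 W ω r) (pathV W ω r) := by
  have e : (fun i => W i r.toNNReal ω) = Sum.elim (fun _ => pathXi W ω r) (pathV W ω r) := by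
    ext (i | j) <;> rfl
  rw [linPath, e, driverMatrix, Matrix.fromBlocks_mulVec]
  ext (i | j)
  · simp only [Sum.elim_comp_inl, Sum.elim_comp_inr, Sum.elim_inl, Matrix.one_mulVec, Pi.add_apply,
      driver, Matrix.mulVec, dotProduct, Matrix.of_apply, ← Finset.mul_sum]
    ring
  · simp

theorem limitVR_eq (k : DetCase) (c R2 : ℝ) {W : Idx m → ℝ≥0 → Ω' → ℝ} {ω : Ω'}
    (hW : ∀ i, Continuous fun t => W i t ω) (hW0 : ∀ i, W i 0 ω = 0) :
    limitVR k c R2 W ω = limitFunctional k c (linPath (driverMatrix m R2) W ω) := by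
  have hz := continuous_linPath (A := driverMatrix m R2) hW (.inl ())
  have hz0 := congrFun (linPath_zero (A := driverMatrix m R2) hW0) (.inl ())
  simp_rw [linPath_driverMatrix] at hz hz0
  have e : ouPath c R2 W ω = ouTransform c (driver R2 W ω) :=
    funext fun r => pathIntegral_exp_eq c hz hz0 r
  unfold limitVR limitFunctional
  simp_rw [linPath_driverMatrix, e]
  rfl

theorem nullLimitVR_eq (k : DetCase) (W : Idx m → ℝ≥0 → Ω' → ℝ) (ω : Ω') :
    nullLimitVR k W ω = limitFunctional k 0 (linPath 1 W ω) := by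
  unfold nullLimitVR limitFunctional linPath
  simp_rw [ouTransform_zero_left, Matrix.one_mulVec]
  rfl

end Limit

/-! ### Invariance of the limit functional -/

section LimitInvariance

variable {m : ℕ}

theorem projectOut_const_mul (a : ℝ) (p : ℝ → ℝ) (q : ℝ → Fin m → ℝ) :
    projectOut (fun r => a * p r) q = fun r => a * projectOut p q r := by
  ext r
  have e : (fun i => ∫ s in (0 : ℝ)..1, q s i * (a * p s)) =
      a • fun i => ∫ s in (0 : ℝ)..1, q s i * p s := by
    ext i
    simp [mul_left_comm _ a]
  unfold projectOut
  rw [e, Matrix.mulVec_smul, dotProduct_smul, smul_eq_mul]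
  ring

theorem projectOut_mulVec (M : Matrix (Fin m) (Fin m) ℝ) (hM : M.det ≠ 0) {p : ℝ → ℝ}
    (hp : Continuous p) {q : ℝ → Fin m → ℝ} (hq : ∀ j, Continuous fun r => q r j) :
    projectOut p (fun r => M *ᵥ q r) = projectOut p q := by
  ext r
  have e1 : pathGram (fun r => M *ᵥ q r) = M * pathGram q * Mᵀ := by
    ext i j
    have hi : ∀ a b, Continuous fun s => M i a * (q s a * q s b * M j b) := by
      intro a b
      have := hq a
      have := hq b
      fun_prop
    simp only [pathGram, Matrix.of_apply, Matrix.mulVec, dotProduct, Finset.sum_mul_sum,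
      Matrix.mul_apply, Matrix.transpose_apply]
    have e : ∀ s, ∑ a, ∑ b, M i a * q s a * (M j b * q s b) =
        ∑ a, ∑ b, M i a * (q s a * q s b * M j b) := fun s =>
      Finset.sum_congr rfl fun a _ => Finset.sum_congr rfl fun b _ => by ring
    simp_rw [e]
    rw [integral_finsetSum_of_continuous _ fun a _ => continuous_finsetSum _ fun b _ => hi a b]
    simp_rw [Finset.sum_mul]
    rw [Finset.sum_comm]
    refine Finset.sum_congr rfl fun a _ => ?_
    rw [integral_finsetSum_of_continuous _ fun b _ => hi _ _]
    refine Finset.sum_congr rfl fun b _ => ?_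
    rw [intervalIntegral.integral_const_mul, intervalIntegral.integral_mul_const]
    ring
  have e2 : (fun i => ∫ s in (0 : ℝ)..1, (M *ᵥ q s) i * p s) =
      M *ᵥ fun i => ∫ s in (0 : ℝ)..1, q s i * p s := by
    ext i
    simp only [Matrix.mulVec, dotProduct, Finset.sum_mul]
    rw [integral_finsetSum_of_continuous _ fun a _ => by have := hq a; fun_prop]
    simp [mul_assoc]
  change p r - M *ᵥ q r ⬝ᵥ ((pathGram fun r => M *ᵥ q r)⁻¹ *ᵥ
    fun i => ∫ s in (0 : ℝ)..1, (M *ᵥ q s) i * p s) = _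
  rw [e1, e2, dotProduct_inv_change M _ hM]
  rfl

theorem ratioFunctional_const_mul {a : ℝ} (ha : a ≠ 0) (g : ℝ → ℝ) :
    ratioFunctional (fun r => a * g r) = ratioFunctional g := by
  unfold ratioFunctional
  simp_rw [intervalIntegral.integral_const_mul, mul_pow, intervalIntegral.integral_const_mul]
  exact mul_div_mul_left _ _ (pow_ne_zero 2 ha)

theorem detrendPath_const_mul (k : DetCase) (a : ℝ) {p : ℝ → ℝ} (hp : Continuous p) :
    detrendPath k (fun r => a * p r) = fun r => a * detrendPath k p r := by
  ext r
  simpa using detrendPath_linear k (Finset.univ : Finset Unit) (fun _ => a) (p := fun _ => p)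
    (fun _ => hp) r

theorem detrendPath_mulVec (k : DetCase) (M : Matrix (Fin m) (Fin m) ℝ) {q : ℝ → Fin m → ℝ}
    (hq : ∀ j, Continuous fun r => q r j) :
    detrendPath k (fun r => M *ᵥ q r) = fun r => M *ᵥ detrendPath k q r := by
  ext r i
  have hqc : Continuous q := continuous_pi hq
  rw [detrendPath_apply k (by fun_prop)]
  simp only [Matrix.mulVec, dotProduct]
  rw [detrendPath_linear k _ _ hq]
  simp_rw [detrendPath_apply k hqc]

theorem ouTransform_const_mul (c a : ℝ) (g : ℝ → ℝ) :
    ouTransform c (fun r => a * g r) = fun r => a * ouTransform c g r := by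
  ext r
  simp_rw [ouTransform, mul_left_comm _ a, intervalIntegral.integral_const_mul]
  ring

theorem limitFunctional_fromBlocks (k : DetCase) (c : ℝ) {z : ℝ → Idx m → ℝ}
    (hz : ∀ i, Continuous fun r => z r i) {a : ℝ} (ha : a ≠ 0) (M : Matrix (Fin m) (Fin m) ℝ)
    (hM : M.det ≠ 0) :
    limitFunctional k c (fun r => Matrix.fromBlocks (Matrix.of fun _ _ => a) 0 0 M *ᵥ z r) =
      limitFunctional k c z := by
  set B : Matrix (Idx m) (Idx m) ℝ := Matrix.fromBlocks (Matrix.of fun _ _ => a) 0 0 M with hB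
  have e1 : ∀ r, (B *ᵥ z r) (.inl ()) =
      a * z r (.inl ()) := by
    intro r
    rw [hB, Matrix.fromBlocks_mulVec]
    simp [Matrix.mulVec, dotProduct]
  have e2 : ∀ r, (fun j : Fin m => (B *ᵥ z r) (Sum.inr j)) =
      M *ᵥ fun j => z r (.inr j) := by
    intro r
    ext j
    rw [hB, Matrix.fromBlocks_mulVec, Sum.elim_inr, Matrix.zero_mulVec, zero_add]
    rfl
  unfold limitFunctional
  rw [show (fun r => (B *ᵥ z r) (.inl ())) = fun r => a * z r (.inl ()) from funext e1,
    show (fun r (j : Fin m) => (B *ᵥ z r) (Sum.inr j)) = _ from funext e2]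
  rw [detrendPath_mulVec k M fun j => hz (.inr j), ouTransform_const_mul,
    detrendPath_const_mul k a (continuous_ouTransform c (hz _)), projectOut_const_mul,
    ratioFunctional_const_mul ha, projectOut_mulVec M hM
    (continuous_detrendPath k (continuous_ouTransform c (hz _))) (continuous_detrendPath_apply k hz)]

end LimitInvariance

end VarianceRatio

namespace VarianceRatio

open Set Topology

/-! ### Vector Brownian motion -/

section Brownian

variable {Ω' : Type*} [MeasurableSpace Ω'] {P' : Measure Ω'} {m : ℕ} {W : Idx m → ℝ≥0 → Ω' → ℝ}

/-- A linear transformation of a vector process. -/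
noncomputable def linProcess (O : Matrix (Idx m) (Idx m) ℝ) (W : Idx m → ℝ≥0 → Ω' → ℝ) :
    Idx m → ℝ≥0 → Ω' → ℝ :=
  fun i t ω => ∑ j, O i j * W j t ω

theorem IsStdBrownian.isGaussianProcess (hW : IsStdBrownian W P') :
    IsGaussianProcess (fun (p : Idx m × ℝ≥0) ω => W p.1 p.2 ω) P' where
  hasGaussianLaw I := by
    classical
    set J := I.image Prod.snd with hJ
    have h1 : HasGaussianLaw (fun ω (i : Idx m) => J.restrict (W i · ω)) P' :=
      iIndepFun.hasGaussianLaw (fun i => (IsPreBrownianReal.isGaussianProcess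
          (hW.brownian i).toIsPreBrownianReal).hasGaussianLaw J)
        (hW.indep.comp (fun _ φ => J.restrict φ) fun _ => Finset.measurable_restrict J)
    let L : (Idx m → J → ℝ) →L[ℝ] I → ℝ :=
      { toFun x p := x p.1.1 ⟨p.1.2, Finset.mem_image_of_mem _ p.2⟩
        map_add' x y := by ext; simp
        map_smul' c x := by ext; simp }
    exact h1.map L

theorem IsStdBrownian.isGaussianProcess_linProcess (hW : IsStdBrownian W P')
    (O : Matrix (Idx m) (Idx m) ℝ) :
    IsGaussianProcess (fun (p : (_ : Idx m) × ℝ≥0) ω => linProcess O W p.1 p.2 ω) P' := by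
  classical
  refine hW.isGaussianProcess.of_isGaussianProcess fun p =>
    ⟨Finset.univ.image fun j => (j, p.2),
      { toFun x := ∑ j, O p.1 j * x ⟨(j, p.2), by simp⟩
        map_add' x y := by simp [mul_add, Finset.sum_add_distrib]
        map_smul' c x := by
          simp only [Pi.smul_apply, smul_eq_mul, RingHom.id_apply, Finset.mul_sum]
          exact Finset.sum_congr rfl fun j _ => by ring }, fun ω => rfl⟩

theorem IsStdBrownian.memLp (hW : IsStdBrownian W P') (i : Idx m) (t : ℝ≥0) :
    MemLp (W i t) 2 P' :=
  ((IsPreBrownianReal.isGaussianProcess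
    (hW.brownian i).toIsPreBrownianReal).hasGaussianLaw_eval t).memLp_two

theorem IsStdBrownian.covariance_eval (hW : IsStdBrownian W P') [IsProbabilityMeasure P']
    (i j : Idx m) (s t : ℝ≥0) :
    cov[W i s, W j t; P'] = if i = j then ((min s t : ℝ≥0) : ℝ) else 0 := by
  split_ifs with h
  · subst h
    exact_mod_cast (hW.brownian i).covariance_eval s t
  · have := (hW.indep.indepFun h).comp (measurable_pi_apply s) (measurable_pi_apply t)
    exact IndepFun.covariance_eq_zero this (hW.memLp i s) (hW.memLp j t)

theorem IsStdBrownian.covariance_linProcess (hW : IsStdBrownian W P') [IsProbabilityMeasure P']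
    (O : Matrix (Idx m) (Idx m) ℝ) (i j : Idx m) (s t : ℝ≥0) :
    cov[linProcess O W i s, linProcess O W j t; P'] = (O * Oᵀ) i j * (min s t : ℝ≥0) := by
  unfold linProcess
  rw [covariance_fun_sum_fun_sum (fun k => (hW.memLp k s).const_mul _)
    fun k => (hW.memLp k t).const_mul _]
  simp_rw [covariance_const_mul_left, covariance_const_mul_right, hW.covariance_eval]
  simp only [mul_ite, mul_zero, Finset.sum_ite_eq, Finset.mem_univ, if_true, Matrix.mul_apply,
    Matrix.transpose_apply, Finset.sum_mul, mul_assoc]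

theorem IsStdBrownian.isPreBrownianReal_linProcess [IsProbabilityMeasure P']
    (hW : IsStdBrownian W P') {O : Matrix (Idx m) (Idx m) ℝ} {i : Idx m} (hO : (O * Oᵀ) i i = 1) :
    IsPreBrownianReal (linProcess O W i) P' := by
  have hGi : IsGaussianProcess (linProcess O W i) P' :=
    (hW.isGaussianProcess_linProcess O).comp_right fun t => (⟨i, t⟩ : (_ : Idx m) × ℝ≥0)
  refine hGi.isPreBrownianReal_of_covariance (fun t => ?_) fun s t hst => ?_
  · unfold linProcess
    rw [integral_finsetSum _ fun j _ => ((hW.memLp j t).integrable one_le_two).const_mul _]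
    refine Finset.sum_eq_zero fun j _ => ?_
    rw [integral_const_mul, (hW.brownian j).integral_eval, mul_zero]
  · rw [hW.covariance_linProcess, hO, min_eq_left hst, one_mul]

theorem IsStdBrownian.isStdBrownian_linProcess [IsProbabilityMeasure P']
    (hW : IsStdBrownian W P') {O : Matrix (Idx m) (Idx m) ℝ} (hO : O * Oᵀ = 1) :
    IsStdBrownian (linProcess O W) P' := by
  have hmeas : ∀ i t, Measurable (linProcess O W i t) := fun i t =>
    Finset.measurable_fun_sum _ fun j _ => (hW.measurable j t).const_mul _
  have hcont : ∀ i ω, Continuous fun t => linProcess O W i t ω := fun i ω =>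
    continuous_finsetSum _ fun j _ => continuous_const.mul (hW.continuous j ω)
  refine ⟨hmeas, hcont, fun i => ⟨hW.isPreBrownianReal_linProcess (by simp [hO]),
    .of_forall (hcont i)⟩, ?_⟩
  refine IsGaussianProcess.iIndepFun_of_covariance_eq_zero (hW.isGaussianProcess_linProcess O)
    (fun i t => (hmeas i t).aemeasurable) fun i j hij s t => ?_
  rw [hW.covariance_linProcess, hO, Matrix.one_apply_ne hij, zero_mul]

theorem IsStdBrownian.measurable_path (hW : IsStdBrownian W P') :
    Measurable fun ω i t => W i t ω :=
  measurable_pi_lambda _ fun i => measurable_pi_lambda _ fun t => hW.measurable i t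

/-- All vector Brownian motions of the same dimension have the same law. -/
theorem IsStdBrownian.map_eq {Ω'' : Type*} [MeasurableSpace Ω''] {P'' : Measure Ω''}
    [IsProbabilityMeasure P'] [IsProbabilityMeasure P''] {W₂ : Idx m → ℝ≥0 → Ω'' → ℝ}
    (hW : IsStdBrownian W P') (hW₂ : IsStdBrownian W₂ P'') :
    P'.map (fun ω i t => W i t ω) = P''.map (fun ω i t => W₂ i t ω) := by
  have hm : ∀ i, Measurable fun ω t => W i t ω := fun i =>
    measurable_pi_lambda _ fun t => hW.measurable i t
  have hm₂ : ∀ i, Measurable fun ω t => W₂ i t ω := fun i =>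
    measurable_pi_lambda _ fun t => hW₂.measurable i t
  rw [(iIndepFun_iff_map_fun_eq_pi_map fun i => (hm i).aemeasurable).1 hW.indep,
    (iIndepFun_iff_map_fun_eq_pi_map fun i => (hm₂ i).aemeasurable).1 hW₂.indep]
  congr 1
  ext1 i
  have h1 := isProjectiveLimit_map (X := fun t => W i t) (P := P') (hm i).aemeasurable
  have h2 := isProjectiveLimit_map (X := fun t => W₂ i t) (P := P'') (hm₂ i).aemeasurable
  simp_rw [((hW.brownian i).hasLaw _).map_eq] at h1
  simp_rw [((hW₂.brownian i).hasLaw _).map_eq] at h2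
  exact h1.unique h2

/-- The normalized increment of a process over `[2^{-k-1}, 2^{-k}]`. -/
noncomputable def dyadicIncr (B : ℝ≥0 → Ω' → ℝ) (k : ℕ) (ω : Ω') : ℝ :=
  √(2 ^ (k + 1)) * (B ((1 / 2) ^ k) ω - B ((1 / 2) ^ (k + 1)) ω)

theorem hasLaw_dyadicIncr {B : ℝ≥0 → Ω' → ℝ} (hB : IsPreBrownianReal B P') (k : ℕ) :
    HasLaw (dyadicIncr B k) (gaussianReal 0 1) P' := by
  have h := gaussianReal_const_mul (hB.hasLaw_sub ((1 / 2) ^ k) ((1 / 2) ^ (k + 1)))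
    (√(2 ^ (k + 1)))
  rw [mul_zero] at h
  convert! h using 2
  ext
  simp only [NNReal.coe_one, NNReal.coe_mul, NNReal.coe_mk, coe_nndist]
  rw [Real.sq_sqrt (by positivity)]
  change 1 = (2 : ℝ) ^ (k + 1) *
    dist (((1 / 2 : ℝ≥0) ^ k : ℝ≥0) : ℝ) (((1 / 2 : ℝ≥0) ^ (k + 1) : ℝ≥0) : ℝ)
  push_cast
  rw [Real.dist_eq, pow_succ (1 / 2 : ℝ), ← mul_one_sub, abs_of_pos (by positivity)]
  rw [pow_succ, one_div, inv_pow]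
  field_simp
  norm_num

theorem indepFun_dyadicIncr {B : ℝ≥0 → Ω' → ℝ} (hB : IsPreBrownianReal B P') {k l : ℕ}
    (hkl : k < l) : IndepFun (dyadicIncr B l) (dyadicIncr B k) P' := by
  let h : ℕ → ℝ≥0 := fun k => (1 / 2) ^ k
  have hanti : Antitone h := pow_right_anti₀ (by positivity) (by norm_num)
  let t : ℕ → ℝ≥0
    | 0 => h (l + 1)
    | 1 => h l
    | 2 => h (k + 1)
    | _ => h k
  have ht : Monotone t := by
    refine monotone_nat_of_le_succ fun n => ?_
    match n with
    | 0 => exact hanti (by omega)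
    | 1 => exact hanti (by omega)
    | 2 => exact hanti (by omega)
    | n + 3 => exact le_rfl
  have := (hB.hasIndepIncrements.nat ht).indepFun (show 0 ≠ 2 by norm_num)
  exact this.comp (measurable_const_mul (√(2 ^ (l + 1)))) (measurable_const_mul (√(2 ^ (k + 1))))

/-- Strong law for the squared increments of Brownian motion at dyadic scales near `0`. -/
theorem ae_tendsto_mean_sq_dyadicIncr {B : ℝ≥0 → Ω' → ℝ} (hB : IsPreBrownianReal B P') :
    ∀ᵐ ω ∂P', Tendsto (fun n : ℕ => (∑ k ∈ Finset.range n, dyadicIncr B k ω ^ 2) / n) atTop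
      (𝓝 1) := by
  have hint : ∫ ω, dyadicIncr B 0 ω ^ 2 ∂P' = 1 := by
    have h := (hasLaw_dyadicIncr hB 0).variance_eq
    have hm : ∫ ω, dyadicIncr B 0 ω ∂P' = 0 := by
      rw [(hasLaw_dyadicIncr hB 0).integral_eq, integral_id_gaussianReal]
    rw [variance_id_gaussianReal, variance_of_integral_eq_zero
      (hasLaw_dyadicIncr hB 0).aemeasurable hm] at h
    simpa using h
  rw [← hint]
  refine strong_law_ae_real (fun k ω => dyadicIncr B k ω ^ 2) ?_ ?_ fun k => ?_
  · exact (hasLaw_dyadicIncr hB 0).hasGaussianLaw.memLp_two.integrable_sq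
  · intro k l hkl
    have hsq : Measurable fun x : ℝ => x ^ 2 := by fun_prop
    rcases lt_or_gt_of_ne hkl with h | h
    · exact ((indepFun_dyadicIncr hB h).comp hsq hsq).symm
    · exact (indepFun_dyadicIncr hB h).comp hsq hsq
  · exact ((hasLaw_dyadicIncr hB k).identDistrib (hasLaw_dyadicIncr hB 0)).comp
      (u := fun x : ℝ => x ^ 2) (by fun_prop)

theorem IsStdBrownian.ae_tendsto_mean_mul_dyadicIncr [IsProbabilityMeasure P']
    (hW : IsStdBrownian W P') (i j : Idx m) :
    ∀ᵐ ω ∂P', Tendsto (fun n : ℕ => (∑ k ∈ Finset.range n,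
      dyadicIncr (W i) k ω * dyadicIncr (W j) k ω) / n) atTop (𝓝 (if i = j then 1 else 0)) := by
  split_ifs with h
  · subst h
    simpa only [sq] using ae_tendsto_mean_sq_dyadicIncr (hW.brownian i).toIsPreBrownianReal
  · set O : Matrix (Idx m) (Idx m) ℝ :=
      Matrix.of fun _ l => (√2)⁻¹ * ((if l = i then 1 else 0) + if l = j then 1 else 0) with hO
    have h2 : (√2)⁻¹ * (√2)⁻¹ = (2 : ℝ)⁻¹ := by
      rw [← mul_inv, Real.mul_self_sqrt (by norm_num)]
    have hOO : (O * Oᵀ) i i = 1 := by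
      have hsum : ∀ l : Idx m, O i l * O i l = 2⁻¹ * ((if l = i then 1 else 0) +
          if l = j then 1 else 0) := by
        intro l
        simp only [hO, Matrix.of_apply]
        rw [mul_mul_mul_comm, h2]
        by_cases h1 : l = i
        · have : l ≠ j := fun h' => h (h1 ▸ h')
          simp [h1, h]
        · by_cases h3 : l = j
          · simp [h3, Ne.symm h]
          · simp [h1, h3]
      simp only [Matrix.mul_apply, Matrix.transpose_apply, hsum]
      rw [← Finset.mul_sum, Finset.sum_add_distrib]
      norm_num
    have hlin : ∀ t ω, linProcess O W i t ω = (√2)⁻¹ * (W i t ω + W j t ω) := by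
      intro t ω
      simp [linProcess, hO, mul_assoc, add_mul, Finset.sum_add_distrib,
        ← Finset.mul_sum]
    filter_upwards [ae_tendsto_mean_sq_dyadicIncr (hW.brownian i).toIsPreBrownianReal,
      ae_tendsto_mean_sq_dyadicIncr (hW.brownian j).toIsPreBrownianReal,
      ae_tendsto_mean_sq_dyadicIncr (hW.isPreBrownianReal_linProcess hOO)] with ω h1 h2' h3
    have h4 := h3.sub ((h1.add h2').mul_const 2⁻¹)
    norm_num at h4
    refine h4.congr fun n => ?_
    rw [← add_div, mul_comm, ← mul_div_assoc, ← sub_div, ← Finset.sum_add_distrib,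
      Finset.mul_sum, ← Finset.sum_sub_distrib]
    congr 1
    refine Finset.sum_congr rfl fun k _ => ?_
    simp only [dyadicIncr, hlin, ← mul_sub]
    have e : ∀ s a b : ℝ, (s * ((√2)⁻¹ * (a + b))) ^ 2 - 1 / 2 * ((s * a) ^ 2 + (s * b) ^ 2) =
        s * a * (s * b) := by
      intro s a b
      rw [mul_pow, mul_pow, sq (√2)⁻¹, h2]
      ring
    rw [← e]
    ring

/-- Almost surely, no nontrivial linear combination of independent Brownian motions is `O(t)`. -/
theorem IsStdBrownian.ae_roughPath [IsProbabilityMeasure P'] (hW : IsStdBrownian W P') :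
    ∀ᵐ ω ∂P', RoughPath fun r i => W i (Real.toNNReal r) ω := by
  have hall : ∀ᵐ ω ∂P', ∀ i j : Idx m, Tendsto (fun n : ℕ => (∑ k ∈ Finset.range n,
      dyadicIncr (W i) k ω * dyadicIncr (W j) k ω) / n) atTop (𝓝 (if i = j then 1 else 0)) :=
    ae_all_iff.2 fun i => ae_all_iff.2 fun j => hW.ae_tendsto_mean_mul_dyadicIncr i j
  filter_upwards [hall] with ω hω
  rintro a ⟨C, hC⟩
  set D : ℕ → ℝ := fun k => ∑ i, a i * dyadicIncr (W i) k ω with hD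
  have hlim1 : Tendsto (fun n : ℕ => (n : ℝ)⁻¹ * ∑ k ∈ Finset.range n, D k ^ 2) atTop
      (𝓝 (∑ i, a i ^ 2)) := by
    have h : Tendsto (fun n : ℕ => ∑ i, ∑ j, a i * a j * ((∑ k ∈ Finset.range n,
        dyadicIncr (W i) k ω * dyadicIncr (W j) k ω) / n)) atTop
        (𝓝 (∑ i, ∑ j, a i * a j * if i = j then 1 else 0)) :=
      tendsto_finsetSum _ fun i _ => tendsto_finsetSum _ fun j _ => (hω i j).const_mul _
    simp only [mul_ite, mul_one, mul_zero, Finset.sum_ite_eq, Finset.mem_univ, if_true,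
      ← sq] at h
    refine h.congr fun n => ?_
    have e : ∀ k, D k ^ 2 =
        ∑ i, ∑ j, a i * a j * (dyadicIncr (W i) k ω * dyadicIncr (W j) k ω) := by
      intro k
      rw [sq, hD, Finset.sum_mul_sum]
      exact Finset.sum_congr rfl fun i _ => Finset.sum_congr rfl fun j _ => by ring
    simp_rw [e]
    have hcomm : ∑ k ∈ Finset.range n, ∑ i, ∑ j,
        a i * a j * (dyadicIncr (W i) k ω * dyadicIncr (W j) k ω) =
        ∑ i, ∑ j, ∑ k ∈ Finset.range n,
          a i * a j * (dyadicIncr (W i) k ω * dyadicIncr (W j) k ω) := by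
      rw [Finset.sum_comm]
      exact Finset.sum_congr rfl fun i _ => Finset.sum_comm
    rw [hcomm, Finset.mul_sum]
    refine Finset.sum_congr rfl fun i _ => ?_
    rw [Finset.mul_sum]
    refine Finset.sum_congr rfl fun j _ => ?_
    rw [← Finset.mul_sum]
    ring
  have hlim2 : Tendsto (fun k => D k ^ 2) atTop (𝓝 0) := by
    have hb : ∀ k, D k ^ 2 ≤ 8 * C ^ 2 * (1 / 2) ^ k := by
      intro k
      set h : ℝ := (1 / 2) ^ k with hh
      have h0 : 0 < h := by positivity
      have h1 : h ≤ 1 := pow_le_one₀ (by norm_num) (by norm_num)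
      have hval : ∀ k : ℕ, (∑ i, a i * W i ((1 / 2) ^ k) ω) =
          a ⬝ᵥ fun i => W i (Real.toNNReal ((1 / 2) ^ k)) ω := by
        intro k
        have : Real.toNNReal ((1 / 2) ^ k) = (1 / 2) ^ k := by
          ext
          rw [Real.coe_toNNReal _ (by positivity)]
          push_cast
          rfl
        rw [this]
        rfl
      have hDk : D k = √(2 ^ (k + 1)) * ((∑ i, a i * W i ((1 / 2) ^ k) ω) -
          ∑ i, a i * W i ((1 / 2) ^ (k + 1)) ω) := by
        rw [hD, ← Finset.sum_sub_distrib, Finset.mul_sum]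
        exact Finset.sum_congr rfl fun i _ => by rw [dyadicIncr]; ring
      have e1 := hC ((1 / 2) ^ k) ⟨by positivity, h1⟩
      have e2 := hC ((1 / 2) ^ (k + 1)) ⟨by positivity, pow_le_one₀ (by norm_num) (by norm_num)⟩
      rw [← hval, ← hh] at e1
      rw [← hval, pow_succ (1 / 2 : ℝ), ← hh] at e2
      have hC0 : 0 ≤ C := by
        by_contra hneg
        have := (abs_nonneg _).trans e1
        nlinarith
      rw [hDk, mul_pow, Real.sq_sqrt (by positivity)]
      have hsq : ((∑ i, a i * W i ((1 / 2) ^ k) ω) - ∑ i, a i * W i ((1 / 2) ^ (k + 1)) ω) ^ 2 ≤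
          (2 * C * h) ^ 2 := by
        refine sq_le_sq' ?_ ?_ <;> rw [abs_le] at * <;> nlinarith [mul_nonneg hC0 h0.le]
      have h2 : (2 : ℝ) ^ (k + 1) * h = 2 := by
        rw [hh, pow_succ, one_div, inv_pow]
        field_simp
      calc _ ≤ (2 : ℝ) ^ (k + 1) * (2 * C * h) ^ 2 := by gcongr
        _ = ((2 : ℝ) ^ (k + 1) * h) * (4 * C ^ 2 * h) := by ring
        _ = _ := by rw [h2]; ring
    refine squeeze_zero (fun k => sq_nonneg _) hb ?_
    simpa using (tendsto_pow_atTop_nhds_zero_of_lt_one (r := (1 / 2 : ℝ)) (by norm_num)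
      (by norm_num)).const_mul (8 * C ^ 2)
  have hzero := tendsto_nhds_unique hlim1 hlim2.cesaro
  ext i
  have := (Finset.sum_eq_zero_iff_of_nonneg fun i _ => sq_nonneg (a i)).1 hzero i
    (Finset.mem_univ i)
  exact pow_eq_zero_iff two_ne_zero |>.1 this

theorem IsStdBrownian.ae_roughPath_linPath [IsProbabilityMeasure P'] (hW : IsStdBrownian W P')
    {A : Matrix (Idx m) (Idx m) ℝ} (hA : A.det ≠ 0) : ∀ᵐ ω ∂P', RoughPath (linPath A W ω) := by
  filter_upwards [hW.ae_roughPath] with ω h a ha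
  have h0 : a ᵥ* A = 0 := by
    refine h _ ?_
    simpa only [linPath, Matrix.dotProduct_mulVec] using ha
  by_contra hne
  exact hA (Matrix.exists_vecMul_eq_zero_iff.1 ⟨a, hne, h0⟩)

theorem IsStdBrownian.ae_zero (hW : IsStdBrownian W P') : ∀ᵐ ω ∂P', ∀ i, W i 0 ω = 0 :=
  ae_all_iff.2 fun i => (hW.brownian i).eval_zero_ae_eq_zero

end Brownian

end VarianceRatio

namespace VarianceRatio

open Set Topology

/-! ### Measurability of the statistic -/

section Measurability

variable {Ω : Type*} [MeasurableSpace Ω] {m n T : ℕ}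

theorem measurable_det_of_apply {G : Ω → Matrix (Fin n) (Fin n) ℝ}
    (hG : ∀ i j, Measurable fun ω => G ω i j) : Measurable fun ω => (G ω).det := by
  simp_rw [Matrix.det_apply']
  exact Finset.measurable_fun_sum _ fun σ _ =>
    (Finset.measurable_fun_prod _ fun i _ => hG _ _).const_mul _

theorem measurable_inv_apply {G : Ω → Matrix (Fin n) (Fin n) ℝ}
    (hG : ∀ i j, Measurable fun ω => G ω i j) (i j : Fin n) :
    Measurable fun ω => (G ω)⁻¹ i j := by
  simp_rw [Matrix.inv_def, Ring.inverse_eq_inv', Matrix.smul_apply, Matrix.adjugate_apply,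
    smul_eq_mul]
  refine (measurable_det_of_apply hG).inv.mul (measurable_det_of_apply fun a b => ?_)
  simp_rw [Matrix.updateRow_apply]
  split_ifs
  · exact measurable_const
  · exact hG a b

theorem measurable_olsResid {z : ℕ → Ω → ℝ} {q : ℕ → Ω → Fin n → ℝ}
    (hz : ∀ t ∈ Finset.Icc 1 T, Measurable (z t)) (hq : ∀ t ∈ Finset.Icc 1 T, Measurable (q t))
    {t : ℕ} (ht : t ∈ Finset.Icc 1 T) :
    Measurable fun ω => olsResid T (fun s => z s ω) (fun s => q s ω) t := by
  have hqj : ∀ s ∈ Finset.Icc 1 T, ∀ j, Measurable fun ω => q s ω j := fun s hs j =>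
    measurable_pi_iff.1 (hq s hs) j
  unfold olsResid Matrix.mulVec dotProduct
  refine (hz t ht).sub (Finset.measurable_fun_sum _ fun i _ => (hqj t ht i).mul
    (Finset.measurable_fun_sum _ fun j _ => (measurable_inv_apply (fun a b => ?_) i j).mul ?_))
  · simp only [gram, Matrix.sum_apply, Matrix.vecMulVec_apply]
    exact Finset.measurable_fun_sum _ fun s hs => (hqj s hs a).mul (hqj s hs b)
  · simp only [crossMoment, Finset.sum_apply, Pi.smul_apply, smul_eq_mul]
    exact Finset.measurable_fun_sum _ fun s hs => (hz s hs).mul (hqj s hs j)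

theorem measurable_VR (k : DetCase) {y : ℕ → Ω → ℝ} {x : ℕ → Ω → Fin m → ℝ}
    (hy : ∀ t ∈ Finset.Icc 1 T, Measurable (y t)) (hx : ∀ t ∈ Finset.Icc 1 T, Measurable (x t)) :
    Measurable fun ω => VR k T (fun t => y t ω) (fun t => x t ω) := by
  have hd : ∀ z : ℕ → Ω → ℝ, (∀ t ∈ Finset.Icc 1 T, Measurable (z t)) →
      ∀ t ∈ Finset.Icc 1 T, Measurable fun ω => olsDetrend k T (fun s => z s ω) t :=
    fun z hz t ht => measurable_olsResid hz (q := fun t _ => k.d t) (fun _ _ => measurable_const) ht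
  have hr : ∀ t ∈ Finset.Icc 1 T,
      Measurable fun ω => residual k T (fun t => y t ω) (fun t => x t ω) t := by
    intro t ht
    refine measurable_olsResid (z := fun t ω => olsDetrend k T (fun s => y s ω) t)
      (q := fun t ω => detrendedX k T (fun s => x s ω) t) (hd y hy) (fun t ht => ?_) ht
    exact measurable_pi_iff.2 fun j =>
      hd (fun s ω => x s ω j) (fun s hs => measurable_pi_iff.1 (hx s hs) j) t ht
  unfold VR
  refine ((Finset.measurable_fun_sum _ fun t ht => ?_).const_mul _).div
    (Finset.measurable_fun_sum _ fun t ht => (hr t ht).pow_const 2)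
  refine (Finset.measurable_fun_sum _ fun s hs => hr s ?_).pow_const 2
  rw [Finset.mem_Icc] at *
  omega

end Measurability

/-! ### The law of the limit variables -/

section Law

variable {Ω' : Type*} [MeasurableSpace Ω'] {P' : Measure Ω'} {m : ℕ} {W : Idx m → ℝ≥0 → Ω' → ℝ}

/-- The autoregression started at `0` with increments of `S` as errors. -/
noncomputable def arSeries (c : ℝ) (T : ℕ) (S : ℕ → ℝ) : ℕ → ℝ
  | 0 => 0
  | t + 1 => (1 + c / T) * arSeries c T S t + (S (t + 1) - S t)

/-- The values of the path `A φ` at the grid points `t / T`. -/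
noncomputable def gridPath (A : Matrix (Idx m) (Idx m) ℝ) (T : ℕ) (φ : Idx m → ℝ≥0 → ℝ) (t : ℕ) :
    Idx m → ℝ :=
  A *ᵥ fun i => φ i (t / T)

/-- The variance ratio statistic computed from the values of a path at the grid points `t / T`. -/
noncomputable def gridVR (k : DetCase) (c : ℝ) (A : Matrix (Idx m) (Idx m) ℝ) (T : ℕ)
    (φ : Idx m → ℝ≥0 → ℝ) : ℝ :=
  VR k T (arSeries c T fun t => gridPath A T φ t (.inl ()))
    (fun t (j : Fin m) => gridPath A T φ t (.inr j))

theorem measurable_gridVR (k : DetCase) (c : ℝ) (A : Matrix (Idx m) (Idx m) ℝ) (T : ℕ) :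
    Measurable (gridVR k c A T) := by
  have hg : ∀ t i, Measurable fun φ => gridPath A T φ t i := by
    intro t i
    unfold gridPath Matrix.mulVec dotProduct
    refine Finset.measurable_fun_sum _ fun j _ => ?_
    have : Measurable fun φ : Idx m → ℝ≥0 → ℝ => φ j (t / T) :=
      (measurable_pi_apply ((t : ℝ≥0) / T)).comp (measurable_pi_apply j)
    exact this.const_mul _
  have ha : ∀ t, Measurable fun φ => arSeries c T (fun t => gridPath A T φ t (.inl ())) t := by
    intro t
    induction t with
    | zero => exact measurable_const
    | succ t ih => exact (ih.const_mul _).add ((hg _ _).sub (hg _ _))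
  exact measurable_VR k (y := fun t φ => arSeries c T (fun t => gridPath A T φ t (.inl ())) t)
    (x := fun t φ j => gridPath A T φ t (.inr j)) (fun t _ => ha t)
    fun t _ => measurable_pi_iff.2 fun j => hg t _

theorem tendsto_gridVR {Ω₀ : Type*} {W : Idx m → ℝ≥0 → Ω₀ → ℝ} (k : DetCase) (c : ℝ)
    {A : Matrix (Idx m) (Idx m) ℝ} {ω : Ω₀}
    (hW : ∀ i, Continuous fun t => W i t ω) (hW0 : ∀ i, W i 0 ω = 0)
    (h : RoughPath (linPath A W ω)) :
    Tendsto (fun T => gridVR k c A T fun i t => W i t ω) atTop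
      (𝓝 (limitFunctional k c (linPath A W ω))) := by
  have hgrid : ∀ T t : ℕ, gridPath A T (fun i t => W i t ω) t = linPath A W ω (t / T) := by
    intro T t
    unfold gridPath linPath
    have : Real.toNNReal ((t : ℝ) / T) = (t : ℝ≥0) / T := by
      ext
      rw [Real.coe_toNNReal _ (by positivity)]
      push_cast
      rfl
    rw [this]
  refine tendsto_VR (T := fun T => T) tendsto_id k c h (continuous_linPath hW) (linPath_zero hW0)
    (s := fun _ => 1) (.of_forall fun _ => one_ne_zero)
    (X := fun T t => gridPath A T (fun i t => W i t ω) t) (fun T => ?_) (fun j => ?_)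
    (u := fun T => arSeries c T fun t => gridPath A T (fun i t => W i t ω) t (.inl ()))
    ?_ (fun T t _ => rfl) (fun T => ⟨0, fun t _ j => ?_⟩) (τ := 0) (β := 0) fun T t _ => ?_
  · rw [hgrid, Nat.cast_zero, zero_div, linPath_zero hW0]
  · simp_rw [one_mul, hgrid]
    exact UnifConv.self fun r => linPath A W ω r j
  · simp [arSeries]
  · simp
  · simp

theorem IsStdBrownian.ae_limitFunctional_eq [IsProbabilityMeasure P'] (hW : IsStdBrownian W P')
    (k : DetCase) (c : ℝ) {A : Matrix (Idx m) (Idx m) ℝ} (hA : A.det ≠ 0) :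
    (fun φ => limUnder atTop fun T => gridVR k c A T φ) ∘ (fun ω i t => W i t ω) =ᵐ[P']
      fun ω => limitFunctional k c (linPath A W ω) := by
  filter_upwards [hW.ae_zero, hW.ae_roughPath_linPath hA] with ω h0 h1
  exact (tendsto_gridVR k c (fun i => hW.continuous i ω) h0 h1).limUnder_eq

theorem measurable_limUnder_gridVR (k : DetCase) (c : ℝ) (A : Matrix (Idx m) (Idx m) ℝ) :
    Measurable fun φ => limUnder atTop fun T => gridVR k c A T φ :=
  (StronglyMeasurable.limUnder (l := atTop) fun T =>
    (measurable_gridVR k c A T).stronglyMeasurable).measurable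

theorem IsStdBrownian.aemeasurable_limitFunctional [IsProbabilityMeasure P']
    (hW : IsStdBrownian W P') (k : DetCase) (c : ℝ) {A : Matrix (Idx m) (Idx m) ℝ}
    (hA : A.det ≠ 0) : AEMeasurable (fun ω => limitFunctional k c (linPath A W ω)) P' :=
  ((measurable_limUnder_gridVR k c A).comp hW.measurable_path).aemeasurable.congr
    (hW.ae_limitFunctional_eq k c hA)

theorem IsStdBrownian.map_limitFunctional_eq [IsProbabilityMeasure P'] (hW : IsStdBrownian W P')
    {Ω'' : Type*} [MeasurableSpace Ω''] {P'' : Measure Ω''} [IsProbabilityMeasure P'']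
    {W₂ : Idx m → ℝ≥0 → Ω'' → ℝ} (hW₂ : IsStdBrownian W₂ P'') (k : DetCase) (c : ℝ)
    {A : Matrix (Idx m) (Idx m) ℝ} (hA : A.det ≠ 0) :
    P'.map (fun ω => limitFunctional k c (linPath A W ω)) =
      P''.map (fun ω => limitFunctional k c (linPath A W₂ ω)) := by
  rw [← Measure.map_congr (hW.ae_limitFunctional_eq k c hA),
    ← Measure.map_congr (hW₂.ae_limitFunctional_eq k c hA),
    ← Measure.map_map (measurable_limUnder_gridVR k c A) hW.measurable_path,
    ← Measure.map_map (measurable_limUnder_gridVR k c A) hW₂.measurable_path, hW.map_eq hW₂]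

theorem det_driverMatrix (m : ℕ) (R2 : ℝ) : (driverMatrix m R2).det ≠ 0 := by
  rw [driverMatrix, Matrix.det_fromBlocks_zero₂₁]
  simp

theorem IsStdBrownian.ae_limitVR_eq (hW : IsStdBrownian W P') (k : DetCase) (c R2 : ℝ) :
    (fun ω => limitFunctional k c (linPath (driverMatrix m R2) W ω)) =ᵐ[P']
      limitVR k c R2 W := by
  filter_upwards [hW.ae_zero] with ω h0
  exact (limitVR_eq k c R2 (fun i => hW.continuous i ω) h0).symm

theorem IsStdBrownian.aemeasurable_limitVR [IsProbabilityMeasure P'] (hW : IsStdBrownian W P')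
    (k : DetCase) (c R2 : ℝ) : AEMeasurable (limitVR k c R2 W) P' :=
  (hW.aemeasurable_limitFunctional k c (det_driverMatrix m R2)).congr (hW.ae_limitVR_eq k c R2)

theorem IsStdBrownian.map_limitVR_eq [IsProbabilityMeasure P'] (hW : IsStdBrownian W P')
    {Ω'' : Type*} [MeasurableSpace Ω''] {P'' : Measure Ω''} [IsProbabilityMeasure P'']
    {W₂ : Idx m → ℝ≥0 → Ω'' → ℝ} (hW₂ : IsStdBrownian W₂ P'') (k : DetCase) (c R2 : ℝ) :
    P'.map (limitVR k c R2 W) = P''.map (limitVR k c R2 W₂) := by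
  rw [← Measure.map_congr (hW.ae_limitVR_eq k c R2), ← Measure.map_congr (hW₂.ae_limitVR_eq k c R2),
    hW.map_limitFunctional_eq hW₂ k c (det_driverMatrix m R2)]

theorem IsStdBrownian.map_nullLimitVR_eq [IsProbabilityMeasure P'] (hW : IsStdBrownian W P')
    {Ω'' : Type*} [MeasurableSpace Ω''] {P'' : Measure Ω''} [IsProbabilityMeasure P'']
    {W₂ : Idx m → ℝ≥0 → Ω'' → ℝ} (hW₂ : IsStdBrownian W₂ P'') (k : DetCase) :
    P'.map (nullLimitVR k W) = P''.map (nullLimitVR k W₂) := by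
  rw [show nullLimitVR k W = _ from funext (nullLimitVR_eq k W),
    show nullLimitVR k W₂ = _ from funext (nullLimitVR_eq k W₂),
    hW.map_limitFunctional_eq hW₂ k 0 (by simp)]

theorem IsStdBrownian.localPower_eq [IsProbabilityMeasure P'] (hW : IsStdBrownian W P')
    {Ω'' : Type*} [MeasurableSpace Ω''] {P'' : Measure Ω''} [IsProbabilityMeasure P'']
    {W₂ : Idx m → ℝ≥0 → Ω'' → ℝ} (hW₂ : IsStdBrownian W₂ P'') (k : DetCase) (c R2 α : ℝ) :
    localPower k c R2 W P' α = localPower k c R2 W₂ P'' α := by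
  unfold localPower
  rw [hW.map_nullLimitVR_eq hW₂ k]
  set q := quantile (P''.map (nullLimitVR k W₂)) α
  have h1 := Measure.map_apply_of_aemeasurable (hW.aemeasurable_limitVR k c R2)
    (measurableSet_Iio (a := q))
  have h2 := Measure.map_apply_of_aemeasurable (hW₂.aemeasurable_limitVR k c R2)
    (measurableSet_Iio (a := q))
  rw [hW.map_limitVR_eq hW₂ k c R2] at h1
  exact congrArg ENNReal.toReal (h1.symm.trans h2)

end Law

end VarianceRatio

namespace VarianceRatio

open Set Topology
open scoped unitInterval ENNReal

/-! ### The extended continuous mapping theorem -/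

section Mapping

variable {Ω Ω' E F : Type*} [MeasurableSpace Ω] [MeasurableSpace Ω'] {P : Measure Ω}
  [IsProbabilityMeasure P] {P' : Measure Ω'} [IsProbabilityMeasure P']
  [TopologicalSpace E] [MeasurableSpace E] [BorelSpace E] [HasOuterApproxClosed E]
  [TopologicalSpace F] [MeasurableSpace F] [BorelSpace F]

/-- If `Z n` converges in distribution to `Z'`, `e n` converges to `0` in probability, and `X n` is
close to `X' ω'` as soon as `n` is large, `Z n` is close to `Z' ω'` and `e n` is close to `0`, then
`X n` converges in distribution to `X'`. -/
theorem tendstoInDistribution_of_forall_tendsto {Z : ℕ → Ω → E} {Z' : Ω' → E}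
    (hZ : TendstoInDistribution Z atTop Z' (fun _ => P) P') {e : ℕ → Ω → ℝ}
    (he : TendstoInMeasure P e atTop fun _ => 0) {X : ℕ → Ω → F} {X' : Ω' → F}
    (hX : ∀ n, AEMeasurable (X n) P) (hX' : AEMeasurable X' P')
    (h : ∀ᵐ ω' ∂P', Tendsto (fun p : ℕ × Ω => X p.1 p.2)
      (comap Prod.fst atTop ⊓ comap (fun p => Z p.1 p.2) (𝓝 (Z' ω')) ⊓
        comap (fun p => e p.1 p.2) (𝓝 0)) (𝓝 (X' ω'))) :
    TendstoInDistribution X atTop X' (fun _ => P) P' where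
  forall_aemeasurable := hX
  aemeasurable_limit := hX'
  tendsto := by
    refine tendsto_of_forall_isClosed_limsup_le' fun C hC => ?_
    set A : ℕ → Set E := fun k => closure {z | ∃ n ≥ k, ∃ ω, Z n ω = z ∧
      dist (e n ω) 0 < 1 / (k + 1 : ℝ) ∧ X n ω ∈ C} with hA
    have hA_anti : Antitone A := by
      intro k l hkl
      refine closure_mono ?_
      rintro z ⟨n, hn, ω, hz, he, hx⟩
      refine ⟨n, hkl.trans hn, ω, hz, he.trans_le ?_, hx⟩
      exact one_div_le_one_div_of_le (by positivity) (by exact_mod_cast Nat.succ_le_succ hkl)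
    have hbound : ∀ k, limsup (fun n => P.map (X n) C) atTop ≤ P'.map Z' (A k) := by
      intro k
      have h1 : Tendsto (fun n => P {ω | 1 / (k + 1 : ℝ) ≤ dist (e n ω) 0}) atTop (𝓝 0) :=
        tendstoInMeasure_iff_dist.1 he _ (by positivity)
      have h2 : limsup (fun n => P.map (Z n) (A k)) atTop ≤ P'.map Z' (A k) :=
        ProbabilityMeasure.limsup_measure_closed_le_of_tendsto hZ.tendsto isClosed_closure
      have h3 : ∀ᶠ n in atTop, P.map (X n) C ≤
          P {ω | 1 / (k + 1 : ℝ) ≤ dist (e n ω) 0} + P.map (Z n) (A k) := by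
        filter_upwards [eventually_ge_atTop k] with n hn
        rw [Measure.map_apply_of_aemeasurable (hX n) hC.measurableSet,
          Measure.map_apply_of_aemeasurable (hZ.forall_aemeasurable n)
            isClosed_closure.measurableSet]
        refine (measure_mono fun ω hω => ?_).trans (measure_union_le _ _)
        by_cases hd : 1 / (k + 1 : ℝ) ≤ dist (e n ω) 0
        · exact Or.inl hd
        · exact Or.inr (subset_closure ⟨n, hn, ω, rfl, not_le.1 hd, hω⟩)
      refine (limsup_le_limsup h3).trans (le_of_eq_of_le ?_ h2)
      exact ENNReal.limsup_add_of_left_tendsto_zero h1 _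
    have hZ' := hZ.aemeasurable_limit
    have hP : IsProbabilityMeasure (P'.map Z') := Measure.isProbabilityMeasure_map hZ'
    have hlim := tendsto_measure_iInter_atTop (μ := P'.map Z')
      (fun k => (isClosed_closure.measurableSet : MeasurableSet (A k)).nullMeasurableSet) hA_anti
      ⟨0, measure_ne_top _ _⟩
    refine (ge_of_tendsto' hlim hbound).trans ?_
    change P'.map Z' _ ≤ P'.map X' C
    rw [Measure.map_apply_of_aemeasurable hX' hC.measurableSet,
      Measure.map_apply_of_aemeasurable hZ'
        (MeasurableSet.iInter fun k => isClosed_closure.measurableSet)]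
    refine measure_mono_ae ?_
    filter_upwards [h] with ω' hω' hmem
    by_contra hx
    have hev := hω' (hC.isOpen_compl.mem_nhds hx)
    obtain ⟨⟨⟨k, U⟩, δ⟩, ⟨⟨-, hU⟩, hδ⟩, hsub⟩ :=
      (((atTop_basis.comap Prod.fst).inf ((𝓝 (Z' ω')).basis_sets.comap fun p : ℕ × Ω =>
        Z p.1 p.2)).inf (Metric.nhds_basis_ball.comap fun p : ℕ × Ω => e p.1 p.2)).mem_iff.1 hev
    obtain ⟨l, hl⟩ := exists_nat_one_div_lt hδ
    have hcl : Z' ω' ∈ A (max k l) := mem_iInter.1 hmem _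
    obtain ⟨z, hzU, n, hn, ω, rfl, hed, hxC⟩ := mem_closure_iff_nhds.1 hcl U hU
    refine hsub (a := (n, ω)) ⟨⟨(le_max_left _ _).trans hn, hzU⟩, ?_⟩ hxC
    refine hed.trans (lt_of_le_of_lt ?_ hl)
    exact one_div_le_one_div_of_le (by positivity)
      (by exact_mod_cast Nat.succ_le_succ (le_max_right k l))

end Mapping

/-! ### Skorokhod convergence to a continuous path -/

theorem eventually_forall_dist_le {E : Type*} [PseudoMetricSpace E] {q : SkorokhodSpace E}
    (hq : Continuous q.toFun) {ε : ℝ} (hε : 0 < ε) :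
    ∀ᶠ p in 𝓝 q, ∀ r, dist (p.toFun r) (q.toFun r) ≤ ε := by
  obtain ⟨δ, hδ, h⟩ := Metric.uniformContinuous_iff.1
    (CompactSpace.uniformContinuous_of_continuous hq) (ε / 2) (by positivity)
  have hη : 0 < min (ENNReal.ofReal δ) (ENNReal.ofReal (ε / 2)) := by simp [hδ, hε]
  filter_upwards [Metric.eball_mem_nhds q hη] with p hp r
  obtain ⟨θ, hθ⟩ := iInf_lt_iff.1 (show skorokhodDist p.toFun q.toFun < _ from hp)
  have h1 : edist r (θ r) < ENNReal.ofReal δ :=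
    ((le_iSup (fun r : I => edist r (θ r)) r).trans (le_max_left _ _)).trans_lt
      (hθ.trans_le (min_le_left _ _))
  have h2 : edist (p.toFun r) (q.toFun (θ r)) < ENNReal.ofReal (ε / 2) :=
    ((le_iSup (fun r : I => edist (p.toFun r) (q.toFun (θ r))) r).trans (le_max_right _ _)).trans_lt
      (hθ.trans_le (min_le_right _ _))
  rw [edist_lt_ofReal] at h1 h2
  have h3 := h h1
  rw [dist_comm] at h3
  linarith [dist_triangle (p.toFun r) (q.toFun (θ r)) (q.toFun r)]

/-! ### The factorization of the root of the long-run covariance matrix -/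

section Root

variable {m : ℕ}

/-- A reflection maps a vector to any other vector of the same length. -/
theorem exists_orthogonal_vecMul_eq {n : Type*} [Fintype n] [DecidableEq n] {u v : n → ℝ}
    (h : u ⬝ᵥ u = v ⬝ᵥ v) : ∃ H : Matrix n n ℝ, H * Hᵀ = 1 ∧ u ᵥ* H = v := by
  by_cases huv : u = v
  · exact ⟨1, by simp, by simpa using huv⟩
  set d := u - v with hd
  have hdd : d ⬝ᵥ d ≠ 0 := fun h0 => huv (sub_eq_zero.1 (dotProduct_self_eq_zero.1 h0))
  have hud : 2 * (u ⬝ᵥ d) = d ⬝ᵥ d := by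
    simp only [hd, dotProduct_sub, sub_dotProduct, dotProduct_comm v u, h]
    ring
  have hv : Matrix.vecMulVec d d * Matrix.vecMulVec d d = (d ⬝ᵥ d) • Matrix.vecMulVec d d := by
    rw [Matrix.vecMulVec_mul_vecMulVec, Matrix.vecMulVec_smul]
  refine ⟨1 - (2 / (d ⬝ᵥ d)) • Matrix.vecMulVec d d, ?_, ?_⟩
  · rw [Matrix.transpose_sub, Matrix.transpose_smul, Matrix.transpose_vecMulVec,
      Matrix.transpose_one, mul_sub, sub_mul, sub_mul]
    simp only [one_mul, mul_one, Matrix.smul_mul, Matrix.mul_smul, hv, smul_smul]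
    rw [show 2 / (d ⬝ᵥ d) * (2 / (d ⬝ᵥ d) * (d ⬝ᵥ d)) = 2 / (d ⬝ᵥ d) + 2 / (d ⬝ᵥ d) by
      field_simp; ring, add_smul]
    abel
  · rw [Matrix.vecMul_sub, Matrix.vecMul_one, Matrix.vecMul_smul, Matrix.vecMul_vecMulVec, smul_smul,
      ← hud]
    have : u ⬝ᵥ d ≠ 0 := fun h0 => hdd (by rw [← hud, h0, mul_zero])
    rw [show 2 / (2 * (u ⬝ᵥ d)) * (u ⬝ᵥ d) = 1 by field_simp, one_smul, hd, sub_sub_cancel]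

variable {Lrv : Matrix (Idx m) (Idx m) ℝ} {S : Matrix (Fin m) (Fin m) ℝ}

theorem posDef_toBlocks₂₂ (h : Lrv.PosDef) : Lrv.toBlocks₂₂.PosDef :=
  h.submatrix Sum.inr_injective

theorem condVar_pos (h : Lrv.PosDef) : 0 < condVar Lrv := by
  have h22 := posDef_toBlocks₂₂ h
  have := h22.isUnit.invertible
  have hdet := h.det_pos
  rw [← Matrix.fromBlocks_toBlocks Lrv, Matrix.det_fromBlocks₂₂] at hdet
  have := pos_of_mul_pos_right hdet h22.det_pos.le
  rwa [Matrix.invOf_eq_nonsing_inv, Matrix.det_unique] at this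

theorem det_root_ne_zero (h : Lrv.PosDef) (hS : S * Sᵀ = Lrv.toBlocks₂₂) : S.det ≠ 0 := by
  intro h0
  have := (posDef_toBlocks₂₂ h).det_pos
  rw [← hS, Matrix.det_mul, h0, zero_mul] at this
  exact lt_irrefl _ this

/-- The length of the loading of `ξ` on `W_v`, relative to the conditional long-run variance. -/
theorem loading_dotProduct (h : Lrv.PosDef) (hS : S * Sᵀ = Lrv.toBlocks₂₂) :
    ((Lrv.toBlocks₁₂ * S⁻¹ᵀ) ()) ⬝ᵥ ((Lrv.toBlocks₁₂ * S⁻¹ᵀ) ()) =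
      condVar Lrv * (rSq Lrv / (1 - rSq Lrv)) := by
  set q := (Lrv.toBlocks₁₂ * Lrv.toBlocks₂₂⁻¹ * Lrv.toBlocks₂₁) () () with hq
  set L := Lrv.toBlocks₁₁ () () with hL
  have h21 : Lrv.toBlocks₂₁ = Lrv.toBlocks₁₂ᵀ := by
    ext i j
    have := congrFun (congrFun h.isHermitian (Sum.inr i)) (Sum.inl j)
    simpa [Matrix.toBlocks₂₁, Matrix.toBlocks₁₂] using this.symm
  have e1 : ((Lrv.toBlocks₁₂ * S⁻¹ᵀ) ()) ⬝ᵥ ((Lrv.toBlocks₁₂ * S⁻¹ᵀ) ()) = q := by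
    have : Lrv.toBlocks₁₂ * S⁻¹ᵀ * (Lrv.toBlocks₁₂ * S⁻¹ᵀ)ᵀ =
        Lrv.toBlocks₁₂ * Lrv.toBlocks₂₂⁻¹ * Lrv.toBlocks₂₁ := by
      rw [h21, ← hS, Matrix.mul_inv_rev, Matrix.transpose_mul, Matrix.transpose_transpose,
        Matrix.transpose_nonsing_inv]
      simp only [Matrix.mul_assoc]
    rw [hq, ← this]
    rfl
  have hLpos : 0 < L := h.diag_pos
  have hcond : condVar Lrv = L - q := rfl
  have hR : rSq Lrv = L⁻¹ * q := by
    rw [rSq, hq, Matrix.mul_assoc, Matrix.mul_assoc, ← Matrix.mul_assoc Lrv.toBlocks₁₂]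
    rw [Matrix.mul_apply]
    simp [Matrix.inv_def, hL]
  have hpos := condVar_pos h
  rw [hcond] at hpos
  rw [e1, hcond, hR, show 1 - L⁻¹ * q = L⁻¹ * (L - q) by field_simp]
  field_simp

theorem lrvRoot_eq_mul (hm : 1 ≤ m) (h : Lrv.PosDef) (hS : S * Sᵀ = Lrv.toBlocks₂₂) :
    ∃ (M : Matrix (Fin m) (Fin m) ℝ) (O : Matrix (Idx m) (Idx m) ℝ), M.det ≠ 0 ∧ O * Oᵀ = 1 ∧
      lrvRoot Lrv S = Matrix.fromBlocks (Matrix.of fun _ _ => √(condVar Lrv)) 0 0 M *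
        (driverMatrix m (rSq Lrv) * O) := by
  set a := √(condVar Lrv) with ha
  have hpos := condVar_pos h
  have ha0 : a ≠ 0 := (Real.sqrt_pos.2 hpos).ne'
  set lam : Fin m → ℝ := (Lrv.toBlocks₁₂ * S⁻¹ᵀ) () with hlam
  have hlen : lam ⬝ᵥ lam = condVar Lrv * (rSq Lrv / (1 - rSq Lrv)) := loading_dotProduct h hS
  have hnn : 0 ≤ rSq Lrv / (1 - rSq Lrv) := by
    refine nonneg_of_mul_nonneg_right ?_ hpos
    rw [← hlen]
    exact Finset.sum_nonneg fun j _ => mul_self_nonneg (lam j)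
  obtain ⟨H, hH, huH⟩ := exists_orthogonal_vecMul_eq
    (u := fun _ : Fin m => √(rSq Lrv / (1 - rSq Lrv)) * (√(m : ℝ))⁻¹) (v := a⁻¹ • lam) (by
      have hm' : (m : ℝ) ≠ 0 := by positivity
      rw [smul_dotProduct, dotProduct_smul, hlen, smul_eq_mul, smul_eq_mul, ← mul_assoc, ← mul_assoc,
        ← mul_inv, ha, Real.mul_self_sqrt hpos.le, inv_mul_cancel₀ hpos.ne', one_mul]
      simp only [dotProduct, Finset.sum_const, Finset.card_univ, Fintype.card_fin, nsmul_eq_mul]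
      rw [mul_mul_mul_comm, Real.mul_self_sqrt hnn, ← mul_inv, Real.mul_self_sqrt (by positivity)]
      field_simp)
  have hH' : Hᵀ * H = 1 := mul_eq_one_comm.1 hH
  refine ⟨S * Hᵀ, Matrix.fromBlocks 1 0 0 H, ?_, ?_, ?_⟩
  · rw [Matrix.det_mul]
    refine mul_ne_zero (det_root_ne_zero h hS) fun h0 => ?_
    have := congrArg Matrix.det hH'
    rw [Matrix.det_mul, h0, zero_mul, Matrix.det_one] at this
    exact zero_ne_one this
  · rw [Matrix.fromBlocks_transpose, Matrix.fromBlocks_multiply]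
    simp [hH]
  · rw [driverMatrix, Matrix.fromBlocks_multiply, Matrix.fromBlocks_multiply, lrvRoot]
    simp only [Matrix.mul_zero, Matrix.zero_mul, Matrix.mul_one, add_zero, zero_add, Matrix.one_mul,
      Matrix.mul_assoc, hH']
    congr 1
    ext i j
    have hj := congrFun huH j
    simp only [Pi.smul_apply, smul_eq_mul] at hj
    have e : (Lrv.toBlocks₁₂ * S⁻¹ᵀ) i j = a * (a⁻¹ * lam j) := by
      rw [mul_inv_cancel_left₀ ha0]
    rw [e, ← hj, Matrix.mul_apply]
    simp only [Finset.univ_unique, Finset.sum_singleton, Matrix.of_apply]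
    rfl

variable {Ω' : Type*} [MeasurableSpace Ω'] {P' : Measure Ω'} {W : Idx m → ℝ≥0 → Ω' → ℝ}

theorem det_lrvRoot_ne_zero (h : Lrv.PosDef) (hS : S * Sᵀ = Lrv.toBlocks₂₂) :
    (lrvRoot Lrv S).det ≠ 0 := by
  rw [lrvRoot, Matrix.det_fromBlocks_zero₂₁, Matrix.det_unique]
  exact mul_ne_zero (Real.sqrt_pos.2 (condVar_pos h)).ne' (det_root_ne_zero h hS)

theorem IsStdBrownian.map_limitFunctional_lrvRoot [IsProbabilityMeasure P']
    (hW : IsStdBrownian W P') (hm : 1 ≤ m) (h : Lrv.PosDef) (hS : S * Sᵀ = Lrv.toBlocks₂₂)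
    (k : DetCase) (c : ℝ) :
    P'.map (fun ω => limitFunctional k c (linPath (lrvRoot Lrv S) W ω)) =
      P'.map (limitVR k c (rSq Lrv) W) := by
  obtain ⟨M, O, hM, hO, hroot⟩ := lrvRoot_eq_mul hm h hS
  have hOW := hW.isStdBrownian_linProcess hO
  have e : ∀ ω, limitFunctional k c (linPath (lrvRoot Lrv S) W ω) =
      limitFunctional k c (linPath (driverMatrix m (rSq Lrv)) (linProcess O W) ω) := by
    intro ω
    rw [← limitFunctional_fromBlocks k c (continuous_linPath fun i => hOW.continuous i ω)
      (Real.sqrt_pos.2 (condVar_pos h)).ne' M hM]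
    congr 1
    ext1 r
    rw [hroot, linPath, ← Matrix.mulVec_mulVec, ← Matrix.mulVec_mulVec]
    rfl
  simp_rw [e]
  rw [hOW.map_limitFunctional_eq hW k c (det_driverMatrix m _),
    Measure.map_congr (hW.ae_limitVR_eq k c _)]

end Root

end VarianceRatio

namespace VarianceRatio

/-- The regressors are the partial sums of their errors, up to deterministic components. -/
theorem exists_eq_sum_add_dotProduct {Ω : Type*} {m : ℕ} {w : ℤ → Ω → Idx m → ℝ} (k : DetCase)
    {drift : Fin m → ℝ} {x : ℕ → Ω → Fin m → ℝ} (hdet : k.Restriction drift (x 0))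
    (hx : ∀ (t : ℕ) (ω : Ω), x (t + 1) ω = drift + x t ω + fun j => w ((t : ℤ) + 1) ω (.inr j))
    (n : ℕ) (ω : Ω) :
    ∃ γ : Fin m → Fin k.dim → ℝ, ∀ t ∈ Finset.Icc 1 n, ∀ j,
      x t ω j = (∑ r ∈ Finset.Icc 1 t, w r ω) (.inr j) + k.d t ⬝ᵥ γ j := by
  have h : ∀ (t : ℕ) j,
      x t ω j = (∑ r ∈ Finset.Icc 1 t, w r ω) (.inr j) + (x 0 ω j + t * drift j) := by
    intro t j
    induction t with
    | zero => simp
    | succ t ih =>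
      rw [hx, Finset.sum_Icc_succ_top (by omega)]
      simp only [Pi.add_apply, ih]
      push_cast
      ring
  cases k with
  | D0 =>
    refine ⟨fun _ => 0, fun t _ j => ?_⟩
    rw [h, hdet.1, hdet.2]
    simp
  | D1 =>
    refine ⟨fun j _ => x 0 ω j, fun t _ j => ?_⟩
    rw [h, show drift = 0 from hdet]
    change _ = _ + ∑ i : Fin 1, _
    simp [DetCase.d]
  | D2 =>
    refine ⟨fun j => ![x 0 ω j, drift j], fun t _ j => ?_⟩
    rw [h]
    change _ = _ + ∑ i : Fin 2, _
    simp [DetCase.d, Fin.sum_univ_two]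

end VarianceRatio

theorem proposition3
    {Ω Ω' Ω'' : Type*} [MeasurableSpace Ω] [MeasurableSpace Ω'] [MeasurableSpace Ω'']
    (P : Measure Ω) [IsProbabilityMeasure P]
    (P' : Measure Ω') [IsProbabilityMeasure P']
    (P'' : Measure Ω'') [IsProbabilityMeasure P'']
    (m : ℕ) (hm : 1 ≤ m) (k : DetCase) (c : ℝ) (hc : c ≤ 0)
    -- the errors `w_t = [ξ_t, v_t']'` and their limit Brownian motion
    (w : ℤ → Ω → Idx m → ℝ)
    (Lrv : Matrix (Idx m) (Idx m) ℝ) (S : Matrix (Fin m) (Fin m) ℝ)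
    (W : Idx m → ℝ≥0 → Ω' → ℝ)
    (hw : ErrorAssumption w P Lrv S W P')
    -- the regressors
    (drift : Fin m → ℝ) (x : ℕ → Ω → Fin m → ℝ)
    (hx0 : Measurable (x 0)) (hdet : k.Restriction drift (x 0))
    (hx : ∀ (t : ℕ) (ω : Ω),
      x (t + 1) ω = drift + x t ω + fun j => w ((t : ℤ) + 1) ω (.inr j))
    -- the regression errors, for each sample size `T`, with `ρ_T = 1 + c / T`
    (u : ℕ → ℕ → Ω → ℝ)
    (hu0_meas : ∀ T, Measurable (u T 0))
    (hu0 : TendstoInMeasure P (fun (T : ℕ) ω => (√(T : ℝ))⁻¹ * u T 0 ω) atTop (fun _ => 0))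
    (hu : ∀ (T t : ℕ), t < T → ∀ ω,
      u T (t + 1) ω = (1 + c / T) * u T t ω + w ((t : ℤ) + 1) ω (.inl ()))
    -- the regressand
    (τ : Fin k.dim → ℝ) (β : Fin m → ℝ) (y : ℕ → ℕ → Ω → ℝ)
    (hy : ∀ (T t : ℕ), 1 ≤ t → t ≤ T → ∀ ω,
      y T t ω = k.d t ⬝ᵥ τ + x t ω ⬝ᵥ β + u T t ω)
    -- an arbitrary standard Brownian motion of the same dimension
    (W₂ : Idx m → ℝ≥0 → Ω'' → ℝ) (hW₂ : IsStdBrownian W₂ P'') :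
    TendstoInDistribution
        (fun (T : ℕ) ω => VR k T (fun t => y T t ω) (fun t => x t ω)) atTop
        (limitVR k c (rSq Lrv) W) (fun _ => P) P' ∧
      P''.map (limitVR k c (rSq Lrv) W₂) = P'.map (limitVR k c (rSq Lrv) W) ∧
      ∀ α ∈ Set.Ioo (0 : ℝ) 1,
        localPower k c (rSq Lrv) W₂ P'' α = localPower k c (rSq Lrv) W P' α := by
  have hdet_root := det_lrvRoot_ne_zero hw.lrv_posDef hw.root
  have hxm : ∀ t, Measurable (x t) := by
    intro t
    induction t with
    | zero => exact hx0
    | succ t ih =>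
      rw [show x (t + 1) = _ from funext (hx t)]
      have := measurable_pi_iff.1 (hw.measurable ((t : ℤ) + 1))
      exact (ih.const_add _).add (measurable_pi_lambda _ fun j => this _)
  have hum : ∀ T, ∀ t ≤ T, Measurable (u T t) := by
    intro T t
    induction t with
    | zero => exact fun _ => hu0_meas T
    | succ t ih =>
      intro ht
      rw [show u T (t + 1) = _ from funext (hu T t ht)]
      exact ((ih (by omega)).const_mul _).add (measurable_pi_iff.1 (hw.measurable _) _)
  have hym : ∀ T, ∀ t ∈ Finset.Icc 1 T, Measurable (y T t) := by
    intro T t ht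
    obtain ⟨h1, h2⟩ := Finset.mem_Icc.1 ht
    rw [show y T t = _ from funext (hy T t h1 h2)]
    refine (Measurable.const_add ?_ _).add (hum T t h2)
    exact Finset.measurable_sum _ fun j _ => (measurable_pi_iff.1 (hxm t) j).mul_const _
  have hlim : TendstoInDistribution
      (fun (T : ℕ) ω => VR k T (fun t => y T t ω) (fun t => x t ω)) atTop
      (fun ω => limitFunctional k c (linPath (lrvRoot Lrv S) W ω)) (fun _ => P) P' := by
    refine tendstoInDistribution_of_forall_tendsto hw.fclt hu0
      (fun T => (measurable_VR k (hym T) fun t _ => hxm t).aemeasurable)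
      (hw.brownian.aemeasurable_limitFunctional k c hdet_root) ?_
    filter_upwards [hw.brownian.ae_roughPath_linPath hdet_root, hw.brownian.ae_zero]
      with ω' hrough hzero
    set l : Filter (ℕ × Ω) := comap Prod.fst atTop ⊓
      comap (fun p => partialSumPath w p.1 p.2)
        (nhds (brownianPath (lrvRoot Lrv S) W hw.brownian.continuous ω')) ⊓
      comap (fun p => (√(p.1 : ℝ))⁻¹ * u p.1 0 p.2) (nhds 0)
    have hT : Tendsto (Prod.fst : ℕ × Ω → ℕ) l atTop :=
      tendsto_comap.mono_left (inf_le_left.trans inf_le_left)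
    have hZ : Tendsto (fun p : ℕ × Ω => partialSumPath w p.1 p.2) l
        (nhds (brownianPath (lrvRoot Lrv S) W hw.brownian.continuous ω')) :=
      tendsto_comap.mono_left (inf_le_left.trans inf_le_right)
    have hcont := continuous_linPath (A := lrvRoot Lrv S) fun i => hw.brownian.continuous i ω'
    refine tendsto_VR (T := Prod.fst) hT k c hrough hcont
      (linPath_zero hzero) (s := fun p => (√(p.1 : ℝ))⁻¹)
      ?_ (X := fun p t => ∑ r ∈ Finset.Icc 1 t, w r p.2) (fun p => by simp) ?_
      (u := fun p t => u p.1 t p.2) (tendsto_comap.mono_left inf_le_right) ?_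
      (x := fun p t => x t p.2) ?_ (y := fun p t => y p.1 t p.2)
      (fun p t ht => hy p.1 t (Finset.mem_Icc.1 ht).1 (Finset.mem_Icc.1 ht).2 p.2)
    · filter_upwards [hT.eventually_gt_atTop 0] with p hp
      have : (0 : ℝ) < p.1 := by exact_mod_cast hp
      positivity
    · intro j ε hε
      have hq : Continuous (brownianPath (lrvRoot Lrv S) W hw.brownian.continuous ω').toFun :=
        (continuous_pi hcont).comp continuous_subtype_val
      filter_upwards [hZ.eventually (eventually_forall_dist_le hq hε)] with p hp t ht
      have h1 := (dist_le_pi_dist _ _ j).trans (hp ⟨_, div_mem_unit ht⟩)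
      obtain ⟨ht1, ht2⟩ := Finset.mem_Icc.1 ht
      have hp0 : (p.1 : ℝ) ≠ 0 := by
        have : p.1 ≠ 0 := by omega
        exact_mod_cast this
      rw [Real.dist_eq] at h1
      change |_ - linPath (lrvRoot Lrv S) W ω' (t / p.1) j| ≤ ε at h1
      simpa [partialSumPath, div_mul_cancel₀ _ hp0] using h1
    · intro p t ht
      rw [hu p.1 t ht p.2, Finset.sum_Icc_succ_top (by omega), Pi.add_apply, add_sub_cancel_left]
      push_cast
      rfl
    · intro p
      exact exists_eq_sum_add_dotProduct k hdet hx p.1 p.2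
  refine ⟨⟨hlim.forall_aemeasurable, hw.brownian.aemeasurable_limitVR k c _, ?_⟩,
    hW₂.map_limitVR_eq hw.brownian k c _, fun α _ => hW₂.localPower_eq hw.brownian k c _ α⟩
  convert hlim.tendsto using 3
  refine congrArg nhds (Subtype.ext ?_)
  exact (hw.brownian.map_limitFunctional_lrvRoot hm hw.lrv_posDef hw.root k c).symm
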